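/- Let $\lambda,\mu,\xi,V>0$, $0<a\le 1$, $b=1-a$, and let $M_1\ge 1$ and $M>M_1+1$ be integers. Attacks on a network occur at times $0\le t_1<t_2<\cdots$ forming a Poisson point process of rate $\lambda$ on $[0,\infty)$. The $k$-th attack destroys $n_k$ nodes with weights $w_{1k},\dots,w_{n_kk}$, where the $n_k$ are i.i.d. geometric, $P\{n_k=j\}=ab^{j-1}$ for $j\ge1$, and the $w_{jk}$ are i.i.d. exponential with rate $\xi$. The process is observed at times $\tau_0=0$, $\tau_m=\Delta_1+\cdots+\Delta_m$, where the $\Delta_i$ are i.i.d. exponential with rate $\mu$. The families $(t_k)$, $(\Delta_i)$, $(n_k)$, $(w_{jk})$ are mutually independent. For $m\ge0$ let $$N_m=\sum_{k:\,t_k\le\tau_m}n_k,\qquad W_m=\sum_{k:\,t_k\le\tau_m}\ \sum_{j=1}^{n_k}w_{jk},$$ and (with $\inf\emptyset=\infty$) $$\nu=\inf\{m\ge0:W_m>V\}.$$ Let $P(x,y)=1-\Gamma(x,y)/\Gamma(x)$ be the regularized incomplete gamma function ($P(0,y)=1$), where $\Gamma(x,y)=\int_y^\infty s^{x-1}e^{-s}\,ds$,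 and put $$d(\theta)=\frac{\lambda+b(\mu+\theta)}{\lambda+\mu+\theta},\qquad r_k^j(u,v,\theta)=e^{-(v+\xi)V}\sum_{i=k}^{j}\frac{[\xi d(\theta)uV]^i}{i!}.$$ (1) If the node levels count as crossed when they are reached, i.e. $\mu_1=\inf\{m\ge0:N_m\ge M_1\}$ and $\mu_2=\inf\{m\ge0:N_m\ge M\}$, then $$P\{\mu_1<\min(\mu_2,\nu)\}=P(M_1-1,\xi V)-\frac{r_{M_1-1}^{M-2}(1,0,0)}{d(0)^{M_1-1}}-d(0)^{M-M_1}P(M-1,\xi V).$$ (2) If the node levels count as crossed when they are exceeded, i.e. $\mu_1=\inf\{m\ge0:N_m>M_1\}$ and $\mu_2=\inf\{m\ge0:N_m>M\}$, then $$P\{\mu_1<\min(\mu_2,\nu)\}=P(M_1,\xi V)-\frac{r_{M_1}^{M-1}(1,0,0)}{d(0)^{M_1}}-d(0)^{M-M_1}P(M,\xi V).$$ -/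

import Mathlib

open MeasureTheory ProbabilityTheory

namespace NetworkAttack

noncomputable section

/-- The number of indices `k` (with multiplicity) such that the attack time `t k` falls in `A`,
i.e. the value on `A` of the counting measure `∑ k, ε_{t k}`. -/
def attackCount {Ω : Type*} (t : ℕ → Ω → ℝ) (A : Set ℝ) (ω : Ω) : ℕ∞ :=
  {k : ℕ | t k ω ∈ A}.encard

/-- The points `t 0 < t 1 < ...` (the attack times `t₁ < t₂ < ...`) form a Poisson point process of
rate `lam` on `[0, ∞)`: the counts of Borel sets of finite length are Poisson with parameter
`lam` times the length, and the counts of pairwise disjoint sets are independent. -/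
structure IsPoissonProcess {Ω : Type*} [MeasurableSpace Ω] (P : Measure Ω)
    (t : ℕ → Ω → ℝ) (lam : ℝ) : Prop where
  measurable : ∀ k, Measurable (t k)
  nonneg : ∀ᵐ ω ∂P, ∀ k, 0 ≤ t k ω
  strictMono : ∀ᵐ ω ∂P, StrictMono fun k => t k ω
  law_count : ∀ A : Set ℝ, MeasurableSet A → A ⊆ Set.Ici 0 → volume A ≠ ⊤ →
    HasLaw (attackCount t A)
      ((poissonMeasure (lam.toNNReal * (volume A).toNNReal)).map (Nat.cast : ℕ → ℕ∞)) P
  indep_count : ∀ A : ℕ → Set ℝ, (∀ i, MeasurableSet (A i)) → (∀ i, A i ⊆ Set.Ici 0) →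
    Pairwise (fun i j => Disjoint (A i) (A j)) → iIndepFun (fun i => attackCount t (A i)) P

/-- The stochastic assumptions of the model. Indices start from `0`:
`t k` is the time of the `(k+1)`-st attack, `n k` the number of nodes it destroys, `w k j` the
weight of the `(j+1)`-st of these nodes, and `Δ i = τ (i+1) - τ i` is an inter-observation time. -/
structure IsModel {Ω : Type*} [MeasurableSpace Ω] (P : Measure Ω)
    (t : ℕ → Ω → ℝ) (Δ : ℕ → Ω → ℝ) (n : ℕ → Ω → ℕ) (w : ℕ → ℕ → Ω → ℝ)
    (lam mu a xi : ℝ) : Prop where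
  /-- attack times: Poisson point process of rate `lam` -/
  poisson : IsPoissonProcess P t lam
  /-- inter-observation times: i.i.d. exponential with rate `mu` -/
  measurable_Δ : ∀ i, Measurable (Δ i)
  law_Δ : ∀ i, HasLaw (Δ i) (expMeasure mu) P
  indep_Δ : iIndepFun Δ P
  /-- nodes lost per strike: i.i.d. geometric on `{1, 2, ...}` with success probability `a` -/
  measurable_n : ∀ k, Measurable (n k)
  law_n : ∀ k j, P {ω | n k ω = j + 1} = ENNReal.ofReal (a * (1 - a) ^ j)
  indep_n : iIndepFun n P
  /-- weights of the nodes: i.i.d. exponential with rate `xi` -/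
  measurable_w : ∀ k j, Measurable (w k j)
  law_w : ∀ k j, HasLaw (w k j) (expMeasure xi) P
  indep_w : iIndepFun (fun (p : ℕ × ℕ) => w p.1 p.2) P
  /-- the four families `t`, `Δ`, `n`, `w` are mutually independent -/
  indep_times_marks : IndepFun (fun ω => ((fun k => t k ω), (fun i => Δ i ω)))
    (fun ω => ((fun k => n k ω), (fun (p : ℕ × ℕ) => w p.1 p.2 ω))) P
  indep_t_Δ : IndepFun (fun ω k => t k ω) (fun ω i => Δ i ω) P
  indep_n_w : IndepFun (fun ω k => n k ω) (fun ω (p : ℕ × ℕ) => w p.1 p.2 ω) P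

/-- The observation times `τ₀ = 0`, `τ_m = Δ₁ + ... + Δ_m`. -/
def obsTime {Ω : Type*} (Δ : ℕ → Ω → ℝ) (m : ℕ) (ω : Ω) : ℝ :=
  ∑ i ∈ Finset.range m, Δ i ω

/-- `N_m`: the number of nodes lost in `[0, τ_m]`. (Almost surely finitely many attacks occur in
`[0, τ_m]`, so this is a genuine finite sum.) -/
def nodesLost {Ω : Type*} (t Δ : ℕ → Ω → ℝ) (n : ℕ → Ω → ℕ) (m : ℕ) (ω : Ω) : ℕ :=
  ∑ᶠ k ∈ {k : ℕ | t k ω ∈ Set.Icc 0 (obsTime Δ m ω)}, n k ω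

/-- `W_m`: the total weight of the nodes lost in `[0, τ_m]`. -/
def weightLost {Ω : Type*} (t Δ : ℕ → Ω → ℝ) (n : ℕ → Ω → ℕ) (w : ℕ → ℕ → Ω → ℝ)
    (m : ℕ) (ω : Ω) : ℝ :=
  ∑ᶠ k ∈ {k : ℕ | t k ω ∈ Set.Icc 0 (obsTime Δ m ω)}, ∑ j ∈ Finset.range (n k ω), w k j ω

/-- `inf {m ≥ 0 : p m}`, equal to `∞` if there is no such `m`. -/
def firstIndex (p : ℕ → Prop) : ℕ∞ :=
  sInf ((fun m : ℕ => (m : ℕ∞)) '' {m | p m})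

/-- The regularized incomplete gamma function `P(x, y) = 1 - Γ(x, y) / Γ(x)`, where
`Γ(x, y) = ∫_y^∞ s^(x-1) e^(-s) ds`. For `x = 0` Mathlib has `Real.Gamma 0 = 0`, and the value
below is `1`, which agrees with the usual `P(0, y) = 1` (`y > 0`). -/
def regGammaP (x y : ℝ) : ℝ :=
  1 - (∫ s in Set.Ioi y, s ^ (x - 1) * Real.exp (-s)) / Real.Gamma x

/-- `d(θ) = (lam + b (mu + θ)) / (lam + mu + θ)` with `b = 1 - a`. -/
def dFun (lam mu a θ : ℝ) : ℝ :=
  (lam + (1 - a) * (mu + θ)) / (lam + mu + θ)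

/-- `r_k^j(u, v, θ) = e^{-(v + xi) V} ∑_{i=k}^j (xi d(θ) u V)^i / i!`. -/
def rFun (lam mu a xi V : ℝ) (k j : ℕ) (u v θ : ℝ) : ℝ :=
  Real.exp (-(v + xi) * V) *
    ∑ i ∈ Finset.Icc k j, (xi * dFun lam mu a θ * u * V) ^ i / (i.factorial : ℝ)

end

end NetworkAttack

/-!
Why the formula holds. Write `p = μ / (λ + μ)`, `b = 1 - a`, and `d = d(0)`, so that `1 - d = a p`.

A Poisson process watched over an independent exponential time of rate `μ` has a geometric number
of points (`lintegral_poisson_expMeasure`), so the numbers of attacks up to the successive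
observation times form a random walk with steps of law `p (1 - p)^r`
(`IsModel.measureReal_countEvent_inter`). A geometric random sum of geometric variables is `0` with
probability `p` and, given that it is positive, geometric with ratio `d` (`hasSum_geomConv`). Hence
`N` is a random walk with step law `stepPMF p d`, and given the values of `N` the weight `W_m` has
the Erlang law with `N_m` stages (`measure_sum_exp_le`, `measureReal_marks`,
`IsModel.measure_nodesLost_eq_and_eq_and_weightLost_le`).

The first passage event is split according to the last index `m` with `N_m < c`
(`firstIndex_lt_min_iff`). Summing over `m` produces the renewal function of the walk, which is
explicit (`hasSum_renewal`). By memorylessness the value of `N` at the passage over `c` is `j ≥ c`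
with probability `(1 - d) d^(j - c)` (`sum_range_renewal_mul_stepPMF`), so the probability of the
event is `∑ (1 - d) d^(j - c) P(j, ξ V)` over `c ≤ j < C`
(`IsModel.measureReal_firstIndex_lt_min`). Since `P(j + 1, x) - P(j, x) = - e^{-x} x^j / j!`,
summation by parts gives the closed form (`sum_geometric_mul_erlangCDF`). Exceeding a level is the
same as reaching the next one, so both parts are instances of one formula.
-/

namespace NetworkAttack

open Filter Topology Set
open scoped ENNReal Nat

/-! ### Erlang distribution functions and exponential integrals -/

/-- The distribution function at `x` of a sum of `c` independent standard exponential variables: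
`1 - e^{-x} ∑_{i < c} x^i / i!`. It equals `1` for `c = 0`. -/
noncomputable def erlangCDF (c : ℕ) (x : ℝ) : ℝ :=
  1 - Real.exp (-x) * ∑ i ∈ Finset.range c, x ^ i / (i ! : ℝ)

lemma erlangCDF_succ (c : ℕ) (x : ℝ) :
    erlangCDF (c + 1) x = erlangCDF c x - Real.exp (-x) * (x ^ c / (c ! : ℝ)) := by
  simp only [erlangCDF, Finset.sum_range_succ]
  ring

lemma hasDerivAt_pow_succ_div_factorial (i : ℕ) (x : ℝ) :
    HasDerivAt (fun s : ℝ => s ^ (i + 1) / ((i + 1) ! : ℝ)) (x ^ i / (i ! : ℝ)) x := by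
  convert! (hasDerivAt_pow (i + 1) x).div_const ((i + 1) ! : ℝ) using 1
  have h1 : (i ! : ℝ) ≠ 0 := by positivity
  have h2 : ((i : ℝ) + 1) ≠ 0 := by positivity
  rw [Nat.factorial_succ]
  push_cast
  field_simp

lemma hasDerivAt_erlangCDF_succ (c : ℕ) (x : ℝ) :
    HasDerivAt (erlangCDF (c + 1)) (Real.exp (-x) * (x ^ c / (c ! : ℝ))) x := by
  induction c with
  | zero =>
    have : erlangCDF 1 = fun x => 1 - Real.exp (-x) := by
      funext y; simp [erlangCDF]
    rw [zero_add, this]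
    convert! ((hasDerivAt_neg x).exp).const_sub 1 using 1
    simp
  | succ c ih =>
    have hfun : erlangCDF (c + 1 + 1) = fun x => erlangCDF (c + 1) x
        - Real.exp (-x) * (x ^ (c + 1) / ((c + 1) ! : ℝ)) := by
      funext y; exact erlangCDF_succ _ _
    rw [hfun]
    convert! ih.sub (((hasDerivAt_neg x).exp).mul (hasDerivAt_pow_succ_div_factorial c x)) using 1
    ring

lemma tendsto_erlangCDF (c : ℕ) : Tendsto (erlangCDF c) atTop (𝓝 1) := by
  have h : Tendsto (fun x : ℝ => ∑ i ∈ Finset.range c, (x ^ i * Real.exp (-x)) / (i ! : ℝ)) atTop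
      (𝓝 (∑ i ∈ Finset.range c, 0 / (i ! : ℝ))) :=
    tendsto_finsetSum _ fun i _ => (Real.tendsto_pow_mul_exp_neg_atTop_nhds_zero i).div_const _
  have h' := h.const_sub 1
  simp only [zero_div, Finset.sum_const_zero, sub_zero] at h'
  refine h'.congr fun x => ?_
  simp only [erlangCDF, Finset.mul_sum]
  congr 1
  exact Finset.sum_congr rfl fun i _ => by ring

lemma erlangCDF_zero_right (c : ℕ) (hc : c ≠ 0) : erlangCDF c 0 = 0 := by
  obtain ⟨c, rfl⟩ := Nat.exists_eq_succ_of_ne_zero hc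
  simp [erlangCDF, Finset.sum_range_succ']

lemma erlangCDF_nonneg (c : ℕ) {x : ℝ} (hx : 0 ≤ x) : 0 ≤ erlangCDF c x := by
  rw [erlangCDF, sub_nonneg]
  calc Real.exp (-x) * ∑ i ∈ Finset.range c, x ^ i / (i ! : ℝ)
      ≤ Real.exp (-x) * Real.exp x := by
        gcongr
        exact Real.sum_le_exp_of_nonneg hx c
    _ = 1 := by rw [← Real.exp_add]; simp

lemma continuous_erlangCDF (c : ℕ) : Continuous (erlangCDF c) := by
  unfold erlangCDF
  fun_prop

/-- For integer parameters the regularized incomplete gamma function is the Erlang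
distribution function. -/
lemma regGammaP_natCast (c : ℕ) {y : ℝ} (hy : 0 ≤ y) : regGammaP c y = erlangCDF c y := by
  cases c with
  | zero =>
    -- `Real.Gamma 0 = 0`, so the quotient in `regGammaP` vanishes and both sides are `1`.
    simp [regGammaP, erlangCDF]
  | succ c =>
    have hint : ∫ s in Ioi y, Real.exp (-s) * (s ^ c / (c ! : ℝ)) = 1 - erlangCDF (c + 1) y :=
      integral_Ioi_of_hasDerivAt_of_nonneg' (fun x _ => hasDerivAt_erlangCDF_succ c x)
        (fun x hx => by have : 0 < x := lt_of_le_of_lt hy hx; positivity)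
        (tendsto_erlangCDF _)
    have hpow : ∀ s : ℝ, s ^ (((c + 1 : ℕ) : ℝ) - 1) = s ^ c := fun s => by
      rw [← Real.rpow_natCast]; simp
    have hΓ : Real.Gamma ((c + 1 : ℕ) : ℝ) = (c ! : ℝ) := by
      push_cast; exact Real.Gamma_nat_eq_factorial c
    have hc : (c ! : ℝ) ≠ 0 := by positivity
    simp only [regGammaP, hpow, hΓ]
    rw [← integral_div]
    have : ∀ s : ℝ, s ^ c * Real.exp (-s) / (c ! : ℝ) = Real.exp (-s) * (s ^ c / (c ! : ℝ)) :=
      fun s => by ring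
    simp only [this, hint]
    ring

lemma lintegral_expMeasure (r : ℝ) {f : ℝ → ℝ≥0∞} (hf : Measurable f) :
    ∫⁻ y, f y ∂expMeasure r
      = ∫⁻ y in Ici 0, ENNReal.ofReal (r * Real.exp (-(r * y))) * f y := by
  have h : expMeasure r
      = volume.withDensity fun y => ENNReal.ofReal (exponentialPDFReal r y) := rfl
  rw [h, lintegral_withDensity_eq_lintegral_mul _
    (measurable_exponentialPDFReal r).ennreal_ofReal hf, ← lintegral_indicator measurableSet_Ici]
  congr 1
  funext y
  change exponentialPDF r y * f y = _
  by_cases hy : 0 ≤ y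
  · simp [exponentialPDF_of_nonneg hy, hy]
  · simp [exponentialPDF_of_neg (not_le.mp hy), hy]

/-- A Poisson process of rate `lam` observed at an independent exponential time of rate `mu` has a
geometrically distributed number of points. -/
lemma lintegral_poisson_expMeasure {lam mu : ℝ} (hlam : 0 < lam) (hmu : 0 < mu) (r : ℕ) :
    ∫⁻ y, ENNReal.ofReal (Real.exp (-(lam * y)) * (lam * y) ^ r / (r ! : ℝ)) ∂expMeasure mu
      = ENNReal.ofReal (mu / (lam + mu) * (lam / (lam + mu)) ^ r) := by
  have hs : 0 < lam + mu := by positivity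
  rw [lintegral_expMeasure _ (by fun_prop), setLIntegral_congr Ioi_ae_eq_Ici.symm]
  set C : ℝ := mu / (lam + mu) * (lam / (lam + mu)) ^ r with hC
  -- Up to a constant the integrand is the density of an Erlang variable with `r + 1` stages of rate
  -- `lam + mu`, which supplies the antiderivative.
  set g : ℝ → ℝ := fun y => C * erlangCDF (r + 1) ((lam + mu) * y) with hg
  set g' : ℝ → ℝ := fun y => mu * Real.exp (-(mu * y)) *
    (Real.exp (-(lam * y)) * (lam * y) ^ r / (r ! : ℝ)) with hg'
  have hderiv : ∀ y ∈ Ici (0 : ℝ), HasDerivAt g (g' y) y := by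
    intro y _
    have h := ((hasDerivAt_erlangCDF_succ r ((lam + mu) * y)).comp y
      ((hasDerivAt_id y).const_mul (lam + mu))).const_mul C
    convert! h using 1
    have he : Real.exp (-((lam + mu) * y)) = Real.exp (-(mu * y)) * Real.exp (-(lam * y)) := by
      rw [← Real.exp_add]; ring_nf
    rw [he, hC, hg']
    simp only [mul_pow, div_pow, mul_one]
    field_simp
  have hpos : ∀ y ∈ Ioi (0 : ℝ), 0 ≤ g' y := fun y hy => by
    have : (0 : ℝ) < y := hy
    simp only [hg']; positivity
  have hlim : Tendsto g atTop (𝓝 C) := by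
    have := ((tendsto_erlangCDF (r + 1)).comp
      (tendsto_id.const_mul_atTop hs)).const_mul C
    simpa using this
  have hint := integrableOn_Ioi_deriv_of_nonneg' hderiv hpos hlim
  have hval := integral_Ioi_of_hasDerivAt_of_nonneg' hderiv hpos hlim
  have h0 : g 0 = 0 := by simp [hg, erlangCDF_zero_right]
  rw [h0, sub_zero] at hval
  rw [← hval, ofReal_integral_eq_lintegral_ofReal hint
    ((ae_restrict_iff' measurableSet_Ioi).2 (ae_of_all _ hpos))]
  refine setLIntegral_congr_fun measurableSet_Ioi fun y _ => ?_
  exact (ENNReal.ofReal_mul (by positivity)).symm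

/-- One step of the convolution of exponential laws. -/
lemma lintegral_erlangCDF_expMeasure {xi : ℝ} (hxi : 0 < xi) (c : ℕ) {v : ℝ} (hv : 0 ≤ v) :
    ∫⁻ y, (Iic v).indicator (fun y => ENNReal.ofReal (erlangCDF c (xi * (v - y)))) y
        ∂expMeasure xi
      = ENNReal.ofReal (erlangCDF (c + 1) (xi * v)) := by
  have hmeas : Measurable fun y => ENNReal.ofReal (erlangCDF c (xi * (v - y))) :=
    ((continuous_erlangCDF c).measurable.comp (by fun_prop)).ennreal_ofReal
  rw [lintegral_expMeasure _ (hmeas.indicator measurableSet_Iic)]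
  have h1 : ∀ y, ENNReal.ofReal (xi * Real.exp (-(xi * y))) *
      (Iic v).indicator (fun y => ENNReal.ofReal (erlangCDF c (xi * (v - y)))) y
      = (Iic v).indicator (fun y => ENNReal.ofReal (xi * Real.exp (-(xi * y)) *
          erlangCDF c (xi * (v - y)))) y := by
    intro y
    by_cases hy : y ∈ Iic v
    · rw [indicator_of_mem hy, indicator_of_mem hy, ← ENNReal.ofReal_mul (by positivity)]
    · rw [indicator_of_notMem hy, indicator_of_notMem hy, mul_zero]
  simp_rw [h1]
  rw [lintegral_indicator measurableSet_Iic, Measure.restrict_restrict measurableSet_Iic,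
    inter_comm, Ici_inter_Iic]
  have hcont : Continuous fun y => xi * Real.exp (-(xi * y)) * erlangCDF c (xi * (v - y)) :=
    (by fun_prop : Continuous fun y => xi * Real.exp (-(xi * y))).mul
      ((continuous_erlangCDF c).comp (by fun_prop))
  have hnn : ∀ y ∈ Icc 0 v, 0 ≤ xi * Real.exp (-(xi * y)) * erlangCDF c (xi * (v - y)) :=
    fun y hy => mul_nonneg (by positivity)
      (erlangCDF_nonneg c (mul_nonneg hxi.le (sub_nonneg.2 hy.2)))
  rw [← ofReal_integral_eq_lintegral_ofReal hcont.continuousOn.integrableOn_Icc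
    ((ae_restrict_iff' measurableSet_Icc).2 (ae_of_all _ hnn)), integral_Icc_eq_integral_Ioc,
    ← intervalIntegral.integral_of_le hv]
  congr 1
  have hderiv : ∀ y ∈ uIcc 0 v, HasDerivAt (fun y => -Real.exp (-(xi * y)) + Real.exp (-(xi * v)) *
      ∑ i ∈ Finset.range c, (xi * (v - y)) ^ (i + 1) / ((i + 1) ! : ℝ))
      (xi * Real.exp (-(xi * y)) * erlangCDF c (xi * (v - y))) y := by
    intro y _
    have hlin : HasDerivAt (fun y => xi * (v - y)) (xi * -1) y :=
      ((hasDerivAt_id y).const_sub v).const_mul xi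
    have hsum : HasDerivAt (fun y => ∑ i ∈ Finset.range c, (xi * (v - y)) ^ (i + 1) /
        ((i + 1) ! : ℝ)) (∑ i ∈ Finset.range c, (xi * (v - y)) ^ i / (i ! : ℝ) * (xi * -1)) y :=
      HasDerivAt.fun_sum fun i _ => (hasDerivAt_pow_succ_div_factorial i _).comp y hlin
    have hexp : HasDerivAt (fun y => -Real.exp (-(xi * y))) (xi * Real.exp (-(xi * y))) y := by
      convert! ((((hasDerivAt_id y).const_mul xi).neg).exp).neg using 1
      simp; ring
    convert! hexp.add (hsum.const_mul (Real.exp (-(xi * v)))) using 1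
    have he : Real.exp (-(xi * v)) = Real.exp (-(xi * y)) * Real.exp (-(xi * (v - y))) := by
      rw [← Real.exp_add]; ring_nf
    rw [erlangCDF, he, ← Finset.sum_mul]
    ring
  rw [intervalIntegral.integral_eq_sub_of_hasDerivAt hderiv (hcont.intervalIntegrable _ _)]
  simp only [sub_self, mul_zero, sub_zero, erlangCDF, Finset.sum_range_succ' _ c]
  simp
  ring

/-! ### Laws of sums of the marks -/

section

variable {Ω : Type*} [MeasurableSpace Ω] {P : Measure Ω}

/-- Fubini's theorem for a pair of independent random variables. -/
lemma measure_pair_mem_eq_lintegral [IsProbabilityMeasure P] {α β : Type*} [MeasurableSpace α]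
    [MeasurableSpace β] {X : Ω → α} {Y : Ω → β} (hX : Measurable X) (hY : Measurable Y)
    (h : IndepFun X Y P) {s : Set (α × β)} (hs : MeasurableSet s) :
    P {ω | (X ω, Y ω) ∈ s} = ∫⁻ ω, P {ω' | (X ω, Y ω') ∈ s} ∂P := by
  have hmap := (indepFun_iff_map_prod_eq_prod_map_map hX.aemeasurable hY.aemeasurable).1 h
  have hYp : IsProbabilityMeasure (P.map Y) := Measure.isProbabilityMeasure_map hY.aemeasurable
  have h1 : P {ω | (X ω, Y ω) ∈ s} = P.map (fun ω => (X ω, Y ω)) s :=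
    (Measure.map_apply (hX.prodMk hY) hs).symm
  rw [h1, hmap, Measure.prod_apply hs, lintegral_map (measurable_measure_prodMk_left hs) hX]
  refine lintegral_congr fun ω => ?_
  exact Measure.map_apply hY (measurable_prodMk_left hs)

lemma expMeasure_Iio_zero (r : ℝ) : expMeasure r (Iio 0) = 0 := by
  rw [← lintegral_indicator_one measurableSet_Iio,
    lintegral_expMeasure _ (measurable_one.indicator measurableSet_Iio),
    setLIntegral_congr_fun (g := fun _ => 0) measurableSet_Ici]
  · simp
  · intro y hy
    have hy' : y ∉ Iio (0 : ℝ) := by simpa using hy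
    simp only [indicator_of_notMem hy', mul_zero]

lemma ae_nonneg_of_hasLaw_expMeasure {X : Ω → ℝ} {r : ℝ} (h : HasLaw X (expMeasure r) P) :
    ∀ᵐ ω ∂P, 0 ≤ X ω := by
  have h1 : P {ω | X ω < 0} = expMeasure r (Iio 0) := h.measure_eq measurableSet_Iio
  rw [expMeasure_Iio_zero] at h1
  rw [ae_iff]
  simpa using h1

/-- Sums of independent exponential variables have the Erlang distribution. -/
lemma measure_sum_exp_le [IsProbabilityMeasure P] {ι : Type*} {X : ι → Ω → ℝ} {xi : ℝ}
    (hxi : 0 < xi) (hX : ∀ i, Measurable (X i)) (hlaw : ∀ i, HasLaw (X i) (expMeasure xi) P)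
    (hind : iIndepFun X P) (F : Finset ι) {v : ℝ} (hv : 0 ≤ v) :
    P {ω | ∑ i ∈ F, X i ω ≤ v} = ENNReal.ofReal (erlangCDF F.card (xi * v)) := by
  classical
  induction F using Finset.induction_on generalizing v with
  | empty => simp [erlangCDF, hv]
  | insert i F hi ih =>
    have hS : Measurable fun ω => ∑ j ∈ F, X j ω := Finset.measurable_fun_sum _ fun j _ => hX j
    have hI : IndepFun (X i) (fun ω => ∑ j ∈ F, X j ω) P := by
      have := (hind.indepFun_finsetSum_of_notMem hX hi).symm
      convert this using 1
      funext ω; simp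
    have hs : MeasurableSet {p : ℝ × ℝ | p.1 + p.2 ≤ v} :=
      measurableSet_le (by fun_prop) (by fun_prop)
    have h := measure_pair_mem_eq_lintegral (hX i) hS hI hs
    simp only [mem_ofPred_eq] at h
    simp only [Finset.sum_insert hi, Finset.card_insert_of_notMem hi]
    -- Condition on `X i`: the other summands must stay below `v - X i`.
    rw [h, ← lintegral_erlangCDF_expMeasure hxi _ hv, ← (hlaw i).map_eq, lintegral_map _ (hX i)]
    · refine lintegral_congr fun ω => ?_
      by_cases hy : X i ω ≤ v
      · rw [indicator_of_mem (show X i ω ∈ Iic v from hy), ← ih (sub_nonneg.2 hy)]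
        congr 1
        ext ω'
        simp [le_sub_iff_add_le, add_comm]
      · -- The remaining summands are almost surely nonnegative, so the sum cannot stay below `v`.
        rw [indicator_of_notMem (show X i ω ∉ Iic v from hy)]
        have h0 : ∀ᵐ ω' ∂P, ∀ j ∈ F, 0 ≤ X j ω' :=
          (ae_ball_iff F.countable_toSet).2 fun j _ => ae_nonneg_of_hasLaw_expMeasure (hlaw j)
        refine measure_mono_null (t := {ω' | ¬ ∀ j ∈ F, 0 ≤ X j ω'}) (fun ω' hω' hn => ?_)
          (ae_iff.1 h0)
        have := Finset.sum_nonneg hn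
        have h2 : X i ω + ∑ j ∈ F, X j ω' ≤ v := hω'
        exact hy (by linarith)
    · exact (((continuous_erlangCDF _).measurable.comp (by fun_prop)).ennreal_ofReal).indicator
        measurableSet_Iic

/-- The geometric probability mass function on `{1, 2, ...}`, extended by `0` at `0`. -/
def geomPMF (a : ℝ) : ℕ → ℝ
  | 0 => 0
  | j + 1 => a * (1 - a) ^ j

/-- The `r`-fold convolution power of the geometric distribution. -/
def geomConv (a : ℝ) : ℕ → ℕ → ℝ
  | 0, e => if e = 0 then 1 else 0
  | r + 1, e => ∑ x ∈ Finset.HasAntidiagonal.antidiagonal e, geomPMF a x.1 * geomConv a r x.2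

lemma measureReal_eq_geomPMF [IsProbabilityMeasure P] {X : Ω → ℕ} {a : ℝ} (ha : 0 < a)
    (ha1 : a ≤ 1) (hX : Measurable X)
    (hlaw : ∀ j, P {ω | X ω = j + 1} = ENNReal.ofReal (a * (1 - a) ^ j)) (j : ℕ) :
    P.real {ω | X ω = j} = geomPMF a j := by
  cases j with
  | succ j =>
    rw [measureReal_def, hlaw, ENNReal.toReal_ofReal (by have := sub_nonneg.2 ha1; positivity)]
    rfl
  | zero =>
    have hmeas : ∀ j, MeasurableSet {ω | X ω = j} := fun j => hX (measurableSet_singleton j)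
    -- The masses of `1, 2, ...` already add up to one.
    have hpos : P {ω | X ω = 0}ᶜ = 1 := by
      have hU : {ω | X ω = 0}ᶜ = ⋃ j, {ω | X ω = j + 1} := by
        ext ω
        simp only [mem_compl_iff, mem_ofPred_eq, mem_iUnion]
        exact ⟨fun h => ⟨X ω - 1, by omega⟩, fun ⟨j, hj⟩ => by omega⟩
      rw [hU, measure_iUnion _ fun j => hmeas (j + 1)]
      · simp only [hlaw]
        have hb : ‖1 - a‖ < 1 := by rw [Real.norm_eq_abs, abs_lt]; constructor <;> linarith
        have hsum := (hasSum_geometric_of_norm_lt_one hb).mul_left a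
        rw [← ENNReal.ofReal_tsum_of_nonneg _ hsum.summable, hsum.tsum_eq]
        · simp [ha.ne']
        · intro j
          have := sub_nonneg.2 ha1
          positivity
      · intro i j hij
        rw [Function.onFun, Set.disjoint_left]
        intro ω h1 h2
        simp only [mem_ofPred_eq] at h1 h2
        omega
    rw [prob_compl_eq_one_iff (hmeas 0)] at hpos
    simp [measureReal_def, hpos, geomPMF]

lemma measureReal_sum_eq_geomConv [IsProbabilityMeasure P] {ι : Type*} {X : ι → Ω → ℕ} {a : ℝ}
    (ha : 0 < a) (ha1 : a ≤ 1) (hX : ∀ i, Measurable (X i))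
    (hlaw : ∀ i j, P {ω | X i ω = j + 1} = ENNReal.ofReal (a * (1 - a) ^ j))
    (hind : iIndepFun X P) (F : Finset ι) (e : ℕ) :
    P.real {ω | ∑ i ∈ F, X i ω = e} = geomConv a F.card e := by
  classical
  induction F using Finset.induction_on generalizing e with
  | empty =>
    by_cases he : e = 0
    · simp [geomConv, he]
    · simp [geomConv, he, Ne.symm he]
  | insert i F hi ih =>
    have hS : Measurable fun ω => ∑ j ∈ F, X j ω := Finset.measurable_fun_sum _ fun j _ => hX j
    have hI : IndepFun (X i) (fun ω => ∑ j ∈ F, X j ω) P := by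
      have := (hind.indepFun_finsetSum_of_notMem hX hi).symm
      convert this using 1
      funext ω; simp
    have hU : {ω | ∑ j ∈ insert i F, X j ω = e} = ⋃ x ∈ Finset.HasAntidiagonal.antidiagonal e,
        (X i ⁻¹' {x.1} ∩ (fun ω => ∑ j ∈ F, X j ω) ⁻¹' {x.2}) := by
      ext ω
      simp [Finset.sum_insert hi]
    rw [hU, measureReal_biUnion_finset]
    · rw [Finset.card_insert_of_notMem hi, geomConv]
      refine Finset.sum_congr rfl fun x _ => ?_
      rw [measureReal_def, hI.measure_inter_preimage_eq_mul _ _ (measurableSet_singleton _)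
        (measurableSet_singleton _), ENNReal.toReal_mul, ← ih x.2,
        ← measureReal_eq_geomPMF ha ha1 (hX i) (hlaw i) x.1]
      rfl
    · intro x _ y _ hxy
      rw [Function.onFun, Set.disjoint_left]
      rintro ω ⟨h1, h2⟩ ⟨h3, h4⟩
      simp only [mem_preimage, mem_singleton_iff] at h1 h2 h3 h4
      exact hxy (Prod.ext (h1.symm.trans h3) (h2.symm.trans h4))
    · intro x _
      exact (hX i (measurableSet_singleton _)).inter (hS (measurableSet_singleton _))

lemma measurable_sum_range_sum_range (L : ℕ) :
    Measurable fun x : (ℕ → ℕ) × (ℕ × ℕ → ℝ) =>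
      ∑ l ∈ Finset.range L, ∑ j ∈ Finset.range (x.1 l), x.2 (l, j) := by
  refine Finset.measurable_fun_sum _ fun l _ => ?_
  have h : Measurable fun y : ℕ × (ℕ × ℕ → ℝ) => ∑ j ∈ Finset.range y.1, y.2 (l, j) :=
    measurable_from_prod_countable_right fun c => by
      dsimp only
      exact Finset.measurable_fun_sum _ fun j _ => measurable_pi_apply (l, j)
  have h' : Measurable fun x : (ℕ → ℕ) × (ℕ × ℕ → ℝ) => (x.1 l, x.2) := by fun_prop
  exact h.comp h'

/-- The numbers of nodes destroyed by the first `k` and by the next `r` attacks are independent. -/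
lemma measureReal_sum_range_and_sum_range_add [IsProbabilityMeasure P] {n : ℕ → Ω → ℕ} {a : ℝ}
    (ha : 0 < a) (ha1 : a ≤ 1) (hn : ∀ k, Measurable (n k))
    (hlaw : ∀ k j, P {ω | n k ω = j + 1} = ENNReal.ofReal (a * (1 - a) ^ j))
    (hind : iIndepFun n P) (k r i e : ℕ) :
    P.real {ω | ∑ l ∈ Finset.range k, n l ω = i ∧ ∑ l ∈ Finset.range (k + r), n l ω = i + e}
      = geomConv a k i * geomConv a r e := by
  have hsplit : ∀ ω, ∑ l ∈ Finset.range (k + r), n l ω =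
      ∑ l ∈ Finset.range k, n l ω + ∑ l ∈ Finset.Ico k (k + r), n l ω := fun ω =>
    (Finset.sum_range_add_sum_Ico _ (Nat.le_add_right k r)).symm
  have hI : IndepFun (fun ω => ∑ l ∈ Finset.range k, n l ω)
      (fun ω => ∑ l ∈ Finset.Ico k (k + r), n l ω) P := by
    have hd : Disjoint (Finset.range k) (Finset.Ico k (k + r)) := by
      rw [Finset.disjoint_left]
      intro l h1 h2
      simp only [Finset.mem_range, Finset.mem_Ico] at h1 h2
      omega
    have h0 := (hind.indepFun_finset _ _ hd hn).comp
      (by fun_prop : Measurable fun x : (Finset.range k → ℕ) => ∑ l, x l)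
      (by fun_prop : Measurable fun x : (Finset.Ico k (k + r) → ℕ) => ∑ l, x l)
    convert h0 using 1
    · funext ω
      exact (Finset.sum_coe_sort (Finset.range k) fun l => n l ω).symm
    · funext ω
      exact (Finset.sum_coe_sort (Finset.Ico k (k + r)) fun l => n l ω).symm
  have hA' : {ω | ∑ l ∈ Finset.range k, n l ω = i ∧
      ∑ l ∈ Finset.range (k + r), n l ω = i + e} =
      (fun ω => ∑ l ∈ Finset.range k, n l ω) ⁻¹' {i} ∩
      (fun ω => ∑ l ∈ Finset.Ico k (k + r), n l ω) ⁻¹' {e} := by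
    ext ω
    simp only [mem_ofPred_eq, hsplit, mem_inter_iff, mem_preimage, mem_singleton_iff]
    omega
  have h1 := measureReal_sum_eq_geomConv ha ha1 hn hlaw hind (Finset.range k) i
  have h2 := measureReal_sum_eq_geomConv ha ha1 hn hlaw hind (Finset.Ico k (k + r)) e
  rw [Finset.card_range] at h1
  rw [Nat.card_Ico, Nat.add_sub_cancel_left] at h2
  rw [hA', measureReal_def, hI.measure_inter_preimage_eq_mul _ _ (measurableSet_singleton _)
      (measurableSet_singleton _), ENNReal.toReal_mul, ← h1, ← h2]
  rfl

/-- Joint law of the marks: given the numbers of nodes destroyed by the first `k` and by the first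
`k + r` attacks, the total weight of the first `k + r` attacks is Erlang distributed. -/
lemma measureReal_marks [IsProbabilityMeasure P] {n : ℕ → Ω → ℕ} {w : ℕ → ℕ → Ω → ℝ} {a xi V : ℝ}
    (ha : 0 < a) (ha1 : a ≤ 1) (hxi : 0 < xi) (hV : 0 ≤ V)
    (hn : ∀ k, Measurable (n k))
    (hlaw : ∀ k j, P {ω | n k ω = j + 1} = ENNReal.ofReal (a * (1 - a) ^ j))
    (hind : iIndepFun n P) (hw : ∀ k j, Measurable (w k j))
    (hwlaw : ∀ k j, HasLaw (w k j) (expMeasure xi) P)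
    (hwind : iIndepFun (fun (p : ℕ × ℕ) => w p.1 p.2) P)
    (hnw : IndepFun (fun ω k => n k ω) (fun ω (p : ℕ × ℕ) => w p.1 p.2 ω) P)
    (k r i e : ℕ) :
    P.real {ω | ∑ l ∈ Finset.range k, n l ω = i ∧ ∑ l ∈ Finset.range (k + r), n l ω = i + e ∧
        ∑ l ∈ Finset.range (k + r), ∑ j ∈ Finset.range (n l ω), w l j ω ≤ V}
      = geomConv a k i * geomConv a r e * erlangCDF (i + e) (xi * V) := by
  set A : Set Ω := {ω | ∑ l ∈ Finset.range k, n l ω = i ∧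
    ∑ l ∈ Finset.range (k + r), n l ω = i + e} with hA
  have hmS : ∀ F : Finset ℕ, Measurable fun ω => ∑ l ∈ F, n l ω := fun F =>
    Finset.measurable_fun_sum _ fun l _ => hn l
  have hAm : MeasurableSet A :=
    (hmS _ (measurableSet_singleton i)).inter (hmS _ (measurableSet_singleton (i + e)))
  have hPA : P.real A = geomConv a k i * geomConv a r e :=
    measureReal_sum_range_and_sum_range_add ha ha1 hn hlaw hind k r i e
  set s : Set ((ℕ → ℕ) × (ℕ × ℕ → ℝ)) := {x | ∑ l ∈ Finset.range k, x.1 l = i ∧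
    ∑ l ∈ Finset.range (k + r), x.1 l = i + e ∧
    ∑ l ∈ Finset.range (k + r), ∑ j ∈ Finset.range (x.1 l), x.2 (l, j) ≤ V} with hs
  have hcoord : ∀ L : ℕ, Measurable fun x : (ℕ → ℕ) × (ℕ × ℕ → ℝ) =>
      ∑ l ∈ Finset.range L, x.1 l := fun L => by fun_prop
  have hsm : MeasurableSet s :=
    (hcoord _ (measurableSet_singleton i)).inter ((hcoord _ (measurableSet_singleton (i + e))).inter
      (measurableSet_le (measurable_sum_range_sum_range _) measurable_const))
  have hfub := measure_pair_mem_eq_lintegral (measurable_pi_lambda _ hn)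
    (measurable_pi_lambda (fun ω (p : ℕ × ℕ) => w p.1 p.2 ω) fun p => hw p.1 p.2) hnw hsm
  have hinner : ∀ ω, P {ω' | ((fun l => n l ω), fun p : ℕ × ℕ => w p.1 p.2 ω') ∈ s} =
      A.indicator (fun _ => ENNReal.ofReal (erlangCDF (i + e) (xi * V))) ω := by
    intro ω
    by_cases hω : ω ∈ A
    · rw [indicator_of_mem hω]
      have h1 := measure_sum_exp_le hxi (X := fun p : (Σ _ : ℕ, ℕ) => w p.1 p.2)
        (fun p => hw p.1 p.2) (fun p => hwlaw p.1 p.2)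
        (hwind.precomp (Equiv.sigmaEquivProd ℕ ℕ).injective)
        ((Finset.range (k + r)).sigma fun l => Finset.range (n l ω)) hV
      rw [Finset.card_sigma] at h1
      simp only [Finset.card_range, hω.2, Finset.sum_sigma] at h1
      rw [← h1]
      congr 1
      ext ω'
      simp only [hs, mem_ofPred_eq]
      exact ⟨fun h => h.2.2, fun h => ⟨hω.1, hω.2, h⟩⟩
    · rw [indicator_of_notMem hω]
      refine measure_mono_null (fun ω' hω' => ?_) measure_empty
      exact hω ⟨hω'.1, hω'.2.1⟩
  rw [lintegral_congr hinner, lintegral_indicator hAm, setLIntegral_const] at hfub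
  rw [measureReal_def]
  have : {ω | ∑ l ∈ Finset.range k, n l ω = i ∧ ∑ l ∈ Finset.range (k + r), n l ω = i + e ∧
        ∑ l ∈ Finset.range (k + r), ∑ j ∈ Finset.range (n l ω), w l j ω ≤ V} =
      {ω | ((fun l => n l ω), fun p : ℕ × ℕ => w p.1 p.2 ω) ∈ s} := rfl
  rw [this, hfub, ENNReal.toReal_mul, ENNReal.toReal_ofReal
    (erlangCDF_nonneg _ (mul_nonneg hxi.le hV)), ← measureReal_def, hPA, mul_comm]

end

/-! ### Attack counts at the observation times -/

section

variable {Ω : Type*} [MeasurableSpace Ω] {P : Measure Ω}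

/-- The pairs `(x, s)` of a time `x` and a sequence of points `s` such that `s 0, ..., s (k - 1)`
are at most `x` and `s k` is larger than `x`. For an increasing sequence this says that exactly `k`
points lie in `(-∞, x]`; unlike the cardinality itself, it is visibly measurable in `(x, s)`. -/
def countSet (k : ℕ) : Set (ℝ × (ℕ → ℝ)) :=
  {z | (∀ i < k, z.2 i ≤ z.1) ∧ z.1 < z.2 k}

lemma measurableSet_countSet (k : ℕ) : MeasurableSet (countSet k) := by
  have h1 : MeasurableSet {z : ℝ × (ℕ → ℝ) | ∀ i < k, z.2 i ≤ z.1} := by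
    have h2 : ∀ i, MeasurableSet {z : ℝ × (ℕ → ℝ) | z.2 i ≤ z.1} := fun i =>
      measurableSet_le ((measurable_pi_apply i).comp measurable_snd) measurable_fst
    simp only [Set.ofPred_forall]
    exact MeasurableSet.iInter fun i => MeasurableSet.iInter fun _ => h2 i
  exact h1.inter (measurableSet_lt measurable_fst ((measurable_pi_apply k).comp measurable_snd))

/-- The almost sure properties of a realization of the Poisson process: the points are nonnegative,
strictly increasing and unbounded. -/
structure IsRegularPath (s : ℕ → ℝ) : Prop where
  nonneg : ∀ k, 0 ≤ s k
  strictMono : StrictMono s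
  unbounded : ∀ x, ∃ k, x < s k

namespace IsRegularPath

variable {s : ℕ → ℝ} (hs : IsRegularPath s)
include hs

lemma exists_mem_countSet (x : ℝ) : ∃ k, (x, s) ∈ countSet k := by
  classical
  exact ⟨Nat.find (hs.unbounded x), fun i hi => not_lt.1 (Nat.find_min (hs.unbounded x) hi),
    Nat.find_spec (hs.unbounded x)⟩

lemma le_iff_of_mem_countSet {x : ℝ} {k : ℕ} (h : (x, s) ∈ countSet k) (i : ℕ) :
    s i ≤ x ↔ i < k := by
  refine ⟨fun hi => ?_, fun hi => h.1 i hi⟩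
  by_contra hk
  exact absurd (lt_of_lt_of_le h.2 (hs.strictMono.monotone (not_lt.1 hk))) (not_lt.2 hi)

lemma le_of_mem_countSet {x y : ℝ} (hxy : x ≤ y) {k l : ℕ} (hk : (x, s) ∈ countSet k)
    (hl : (y, s) ∈ countSet l) : k ≤ l := by
  by_contra h
  have h1 := (hs.le_iff_of_mem_countSet hk l).2 (not_le.1 h)
  exact absurd ((hs.le_iff_of_mem_countSet hl l).1 (h1.trans hxy)) (lt_irrefl l)

lemma eq_of_mem_countSet {x : ℝ} {k l : ℕ} (hk : (x, s) ∈ countSet k)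
    (hl : (x, s) ∈ countSet l) : k = l :=
  le_antisymm (hs.le_of_mem_countSet le_rfl hk hl) (hs.le_of_mem_countSet le_rfl hl hk)

lemma setOf_mem_Icc {x : ℝ} {k : ℕ} (h : (x, s) ∈ countSet k) :
    {i | s i ∈ Icc 0 x} = Finset.range k := by
  ext i
  simp [hs.nonneg i, hs.le_iff_of_mem_countSet h]

lemma encard_mem_Icc_eq_iff (x : ℝ) (k : ℕ) :
    {i | s i ∈ Icc 0 x}.encard = k ↔ (x, s) ∈ countSet k := by
  obtain ⟨l, hl⟩ := hs.exists_mem_countSet x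
  rw [hs.setOf_mem_Icc hl, Set.encard_coe_eq_coe_finsetCard, Finset.card_range]
  refine ⟨fun h => ?_, fun h => ?_⟩
  · rw [Nat.cast_inj] at h
    exact h ▸ hl
  · rw [hs.eq_of_mem_countSet hl h]

lemma encard_mem_Ioc_eq_iff {x y : ℝ} (hxy : x ≤ y) {k : ℕ} (hk : (x, s) ∈ countSet k) (r : ℕ) :
    {i | s i ∈ Ioc x y}.encard = r ↔ (y, s) ∈ countSet (k + r) := by
  obtain ⟨l, hl⟩ := hs.exists_mem_countSet y
  have hkl := hs.le_of_mem_countSet hxy hk hl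
  have hset : {i | s i ∈ Ioc x y} = Finset.Ico k l := by
    ext i
    rw [mem_ofPred_eq, mem_Ioc, ← not_le, hs.le_iff_of_mem_countSet hl,
      hs.le_iff_of_mem_countSet hk]
    simp
  rw [hset, Set.encard_coe_eq_coe_finsetCard, Nat.card_Ico, Nat.cast_inj]
  refine ⟨fun h => ?_, fun h => ?_⟩
  · have : k + r = l := by omega
    exact this ▸ hl
  · have := hs.eq_of_mem_countSet hl h
    omega

end IsRegularPath

/-- The Poisson probability of `k` points when the mean is `x`. -/
noncomputable def poissonPMF (x : ℝ) (k : ℕ) : ℝ := Real.exp (-x) * x ^ k / (k ! : ℝ)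

namespace IsPoissonProcess

variable {t : ℕ → Ω → ℝ} {lam : ℝ} (ht : IsPoissonProcess P t lam)
include ht

lemma measure_attackCount_eq (hlam : 0 ≤ lam) {A : Set ℝ} (hA : MeasurableSet A)
    (hA0 : A ⊆ Ici 0) {x : ℝ} (hx : 0 ≤ x) (hvol : volume A = ENNReal.ofReal x) (k : ℕ) :
    P {ω | attackCount t A ω = k} = ENNReal.ofReal (poissonPMF (lam * x) k) := by
  have h := (ht.law_count A hA hA0 (by simp [hvol])).measure_eq
    (p := fun c => c = (k : ℕ∞)) (MeasurableSet.of_discrete)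
  rw [h, Measure.map_apply (by fun_prop) MeasurableSet.of_discrete]
  have hpre : (Nat.cast : ℕ → ℕ∞) ⁻¹' {c | c = (k : ℕ∞)} = {k} := by
    ext j
    simp
  have hrate : ((lam.toNNReal * (ENNReal.ofReal x).toNNReal : NNReal) : ℝ) = lam * x := by
    rw [NNReal.coe_mul, Real.coe_toNNReal _ hlam, ENNReal.coe_toNNReal_eq_toReal,
      ENNReal.toReal_ofReal hx]
  rw [hpre, poissonMeasure_singleton, hvol, hrate]
  rfl

lemma ae_isRegularPath : ∀ᵐ ω ∂P, IsRegularPath fun k => t k ω := by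
  have hfin : ∀ᵐ ω ∂P, ∀ N : ℕ, attackCount t (Icc 0 (N : ℝ)) ω ≠ ⊤ := by
    rw [ae_all_iff]
    intro N
    have hlaw := ht.law_count (Icc 0 (N : ℝ)) measurableSet_Icc Icc_subset_Ici_self (by simp)
    have h := hlaw.measure_eq (p := fun c => c = ⊤) (MeasurableSet.of_discrete)
    rw [Measure.map_apply (by fun_prop) MeasurableSet.of_discrete] at h
    rw [ae_iff]
    simp only [ne_eq, not_not]
    rw [h]
    refine measure_mono_null (fun j hj => ?_) measure_empty
    exact absurd hj (by simp)
  filter_upwards [ht.nonneg, ht.strictMono, hfin] with ω h0 h1 h2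
  refine ⟨h0, h1, fun x => ?_⟩
  -- A bounded path would have infinitely many points in some `[0, N]`.
  by_contra! hx
  obtain ⟨N, hN⟩ := exists_nat_ge x
  refine h2 N ?_
  have : {k | t k ω ∈ Icc 0 (N : ℝ)} = univ := by
    ext k
    simpa using ⟨h0 k, (hx k).trans hN⟩
  rw [attackCount, this, Set.encard_univ, ENat.card_eq_top_of_infinite]

lemma measure_countSet (hlam : 0 ≤ lam) {x : ℝ} (hx : 0 ≤ x) (k : ℕ) :
    P {ω | (x, fun i => t i ω) ∈ countSet k} = ENNReal.ofReal (poissonPMF (lam * x) k) := by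
  rw [← ht.measure_attackCount_eq hlam measurableSet_Icc Icc_subset_Ici_self hx
    (by rw [Real.volume_Icc, sub_zero])]
  refine measure_congr ?_
  filter_upwards [ht.ae_isRegularPath] with ω hω
  exact propext (hω.encard_mem_Icc_eq_iff x k).symm

lemma measure_countSet_inter (hlam : 0 ≤ lam) {x y : ℝ} (hx : 0 ≤ x) (hy : 0 ≤ y) (k r : ℕ) :
    P {ω | (x, fun i => t i ω) ∈ countSet k ∧ (x + y, fun i => t i ω) ∈ countSet (k + r)} =
      ENNReal.ofReal (poissonPMF (lam * x) k) * ENNReal.ofReal (poissonPMF (lam * y) r) := by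
  set A : ℕ → Set ℝ := fun i => if i = 0 then Icc 0 x else if i = 1 then Ioc x (x + y) else ∅
    with hA
  have hm : ∀ i, MeasurableSet (A i) := fun i => by
    simp only [hA]; split_ifs <;> measurability
  have hsub1 : Ioc x (x + y) ⊆ Ici 0 := fun z hz => hx.trans hz.1.le
  have hsub : ∀ i, A i ⊆ Ici 0 := fun i => by
    simp only [hA]; split_ifs
    · exact Icc_subset_Ici_self
    · exact hsub1
    · exact empty_subset _
  have hd01 : Disjoint (Icc 0 x) (Ioc x (x + y)) := by
    rw [Set.disjoint_left]
    intro z h1 h2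
    exact absurd h1.2 (not_le.2 h2.1)
  have hd : Pairwise fun i j => Disjoint (A i) (A j) := by
    intro i j hij
    simp only [hA]
    split_ifs <;> first | omega | exact hd01 | exact hd01.symm | simp
  have hind := (ht.indep_count A hm hsub hd).indepFun (zero_ne_one)
  have hmul := hind.measure_inter_preimage_eq_mul {(k : ℕ∞)} {(r : ℕ∞)}
    MeasurableSet.of_discrete MeasurableSet.of_discrete
  have h0 := ht.measure_attackCount_eq hlam (measurableSet_Icc (a := 0) (b := x))
    Icc_subset_Ici_self hx (by rw [Real.volume_Icc, sub_zero]) k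
  have h1 := ht.measure_attackCount_eq hlam (measurableSet_Ioc (a := x) (b := x + y))
    hsub1 hy (by rw [Real.volume_Ioc]; ring_nf) r
  rw [← h0, ← h1]
  refine Eq.trans (measure_congr ?_) hmul
  filter_upwards [ht.ae_isRegularPath] with ω hω
  refine propext ⟨fun h => ⟨?_, ?_⟩, fun h => ?_⟩
  · exact (hω.encard_mem_Icc_eq_iff x k).2 h.1
  · exact (hω.encard_mem_Ioc_eq_iff (le_add_of_nonneg_right hy) h.1 r).2 h.2
  · have hk := (hω.encard_mem_Icc_eq_iff x k).1 h.1
    exact ⟨hk, (hω.encard_mem_Ioc_eq_iff (le_add_of_nonneg_right hy) hk r).1 h.2⟩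

end IsPoissonProcess

/-- The event that exactly `k` attacks occur up to the `m`-th observation time. -/
def countEvent (t Δ : ℕ → Ω → ℝ) (m k : ℕ) : Set Ω :=
  {ω | (obsTime Δ m ω, fun i => t i ω) ∈ countSet k}

lemma measurable_obsTime {Δ : ℕ → Ω → ℝ} (hΔ : ∀ i, Measurable (Δ i)) (m : ℕ) :
    Measurable (obsTime Δ m) :=
  Finset.measurable_fun_sum _ fun i _ => hΔ i

lemma measurableSet_countEvent {t Δ : ℕ → Ω → ℝ} (ht : ∀ k, Measurable (t k))
    (hΔ : ∀ i, Measurable (Δ i)) (m k : ℕ) : MeasurableSet (countEvent t Δ m k) :=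
  ((measurable_obsTime hΔ m).prodMk (measurable_pi_lambda _ ht)) (measurableSet_countSet k)

namespace IsModel

variable {t Δ : ℕ → Ω → ℝ} {n : ℕ → Ω → ℕ} {w : ℕ → ℕ → Ω → ℝ} {lam mu a xi : ℝ}

lemma ae_nonneg_interarrival (h : IsModel P t Δ n w lam mu a xi) :
    ∀ᵐ ω ∂P, ∀ i, 0 ≤ Δ i ω :=
  ae_all_iff.2 fun i => ae_nonneg_of_hasLaw_expMeasure (h.law_Δ i)

lemma measure_countEvent [IsProbabilityMeasure P] (h : IsModel P t Δ n w lam mu a xi)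
    (hlam : 0 ≤ lam) (m k : ℕ) :
    P (countEvent t Δ m k) = ∫⁻ ω, ENNReal.ofReal (poissonPMF (lam * obsTime Δ m ω) k) ∂P := by
  have hI : IndepFun (obsTime Δ m) (fun ω i => t i ω) P :=
    h.indep_t_Δ.symm.comp
      (by fun_prop : Measurable fun δ : ℕ → ℝ => ∑ i ∈ Finset.range m, δ i) measurable_id
  have hf := measure_pair_mem_eq_lintegral (measurable_obsTime h.measurable_Δ m)
    (measurable_pi_lambda _ h.poisson.measurable) hI (measurableSet_countSet k)
  refine hf.trans (lintegral_congr_ae ?_)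
  filter_upwards [h.ae_nonneg_interarrival] with ω hω
  exact h.poisson.measure_countSet hlam (Finset.sum_nonneg fun i _ => hω i) k

/-- The numbers of attacks up to the successive observation times form a random walk with
geometrically distributed steps. -/
lemma measureReal_countEvent_inter [IsProbabilityMeasure P] (h : IsModel P t Δ n w lam mu a xi)
    (hlam : 0 < lam) (hmu : 0 < mu) (m k r : ℕ) :
    P.real (countEvent t Δ m k ∩ countEvent t Δ (m + 1) (k + r)) =
      P.real (countEvent t Δ m k) * (mu / (lam + mu) * (lam / (lam + mu)) ^ r) := by
  have hI : IndepFun (fun ω => (obsTime Δ m ω, Δ m ω)) (fun ω i => t i ω) P :=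
    h.indep_t_Δ.symm.comp
      (by fun_prop : Measurable fun δ : ℕ → ℝ => (∑ i ∈ Finset.range m, δ i, δ m)) measurable_id
  have hτ := measurable_obsTime h.measurable_Δ m
  have hI' : IndepFun (obsTime Δ m) (Δ m) P := by
    have := h.indep_Δ.indepFun_finsetSum_of_notMem h.measurable_Δ
      (Finset.notMem_range_self (n := m))
    convert this using 1
    funext ω; simp [obsTime]
  have hsm : MeasurableSet {z : (ℝ × ℝ) × (ℕ → ℝ) | (z.1.1, z.2) ∈ countSet k ∧
      (z.1.1 + z.1.2, z.2) ∈ countSet (k + r)} :=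
    (MeasurableSet.inter
      ((by fun_prop : Measurable fun z : (ℝ × ℝ) × (ℕ → ℝ) => (z.1.1, z.2))
        (measurableSet_countSet k))
      ((by fun_prop : Measurable fun z : (ℝ × ℝ) × (ℕ → ℝ) => (z.1.1 + z.1.2, z.2))
        (measurableSet_countSet (k + r))))
  have hf := measure_pair_mem_eq_lintegral (hτ.prodMk (h.measurable_Δ m))
    (measurable_pi_lambda _ h.poisson.measurable) hI hsm
  have hset : countEvent t Δ m k ∩ countEvent t Δ (m + 1) (k + r) =
      {ω | ((obsTime Δ m ω, Δ m ω), fun i => t i ω) ∈ {z : (ℝ × ℝ) × (ℕ → ℝ) |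
        (z.1.1, z.2) ∈ countSet k ∧ (z.1.1 + z.1.2, z.2) ∈ countSet (k + r)}} := by
    ext ω
    simp only [countEvent, obsTime, Finset.sum_range_succ, mem_inter_iff, mem_ofPred_eq]
  have hp : Measurable fun y : ℝ => ENNReal.ofReal (poissonPMF (lam * y) r) := by
    unfold poissonPMF; fun_prop
  have hp' : Measurable fun y : ℝ => ENNReal.ofReal (poissonPMF (lam * y) k) := by
    unfold poissonPMF; fun_prop
  have hprod : P (countEvent t Δ m k ∩ countEvent t Δ (m + 1) (k + r)) =
      P (countEvent t Δ m k) *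
        ENNReal.ofReal (mu / (lam + mu) * (lam / (lam + mu)) ^ r) := by
    rw [hset, hf, h.measure_countEvent hlam.le, ← lintegral_poisson_expMeasure hlam hmu r,
      ← (h.law_Δ m).map_eq, lintegral_map (by fun_prop) (h.measurable_Δ m)]
    refine Eq.trans (lintegral_congr_ae ?_)
      (lintegral_mul_eq_lintegral_mul_lintegral_of_indepFun (hp'.comp hτ)
        (hp.comp (h.measurable_Δ m)) (hI'.comp hp' hp))
    filter_upwards [h.ae_nonneg_interarrival] with ω hω
    exact h.poisson.measure_countSet_inter hlam.le (Finset.sum_nonneg fun i _ => hω i) (hω m) k r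
  rw [measureReal_def, hprod, ENNReal.toReal_mul, ENNReal.toReal_ofReal (by positivity)]
  rfl

end IsModel

end

/-! ### The random walk of lost nodes -/

/-- The law of the number of nodes destroyed between two observations, where `p` is the probability
of no attack and `d` is the ratio `d(0)`: conditionally on being positive, it is geometric. -/
def stepPMF (p d : ℝ) : ℕ → ℝ
  | 0 => p
  | e + 1 => (1 - p) * (1 - d) * d ^ e

lemma stepPMF_nonneg {p d : ℝ} (hp : 0 ≤ p) (hp1 : p ≤ 1) (hd : 0 ≤ d) (hd1 : d ≤ 1) (e : ℕ) :
    0 ≤ stepPMF p d e := by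
  cases e with
  | zero => exact hp
  | succ e =>
    have := sub_nonneg.2 hp1
    have := sub_nonneg.2 hd1
    simp only [stepPMF]
    positivity

lemma sum_antidiagonal_geometric_mul_stepPMF {p d a : ℝ} (hd : 1 - d = a * p) (e : ℕ) :
    ∑ x ∈ Finset.HasAntidiagonal.antidiagonal e, a * (1 - a) ^ x.1 * stepPMF p d x.2
      = (1 - d) * d ^ e := by
  induction e with
  | zero => simp [stepPMF, hd]
  | succ e ih =>
    have h : ∀ x : ℕ × ℕ, a * (1 - a) ^ (x.1 + 1) * stepPMF p d x.2
        = (1 - a) * (a * (1 - a) ^ x.1 * stepPMF p d x.2) := fun x => by ring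
    rw [Finset.Nat.sum_antidiagonal_succ]
    simp only [h, ← Finset.mul_sum, ih]
    simp only [stepPMF]
    linear_combination (1 - d) * d ^ e * hd

/-- A geometric random sum of independent geometric variables: its law is a mixture of the point
mass at `0` and a geometric law. -/
lemma hasSum_geomConv {p d a : ℝ} (hd : 1 - d = a * p) (e : ℕ) :
    HasSum (fun r => p * (1 - p) ^ r * geomConv a r e) (stepPMF p d e) := by
  induction e using Nat.strong_induction_on with
  | _ e ih =>
    have hterm : ∀ x ∈ Finset.HasAntidiagonal.antidiagonal e,
        HasSum (fun r => (1 - p) * geomPMF a x.1 * (p * (1 - p) ^ r * geomConv a r x.2))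
          ((1 - p) * geomPMF a x.1 * stepPMF p d x.2) := by
      rintro ⟨j, e'⟩ hx
      rw [Finset.HasAntidiagonal.mem_antidiagonal] at hx
      -- The term with `e' = e` drops out because `geomPMF a 0 = 0`; this makes the induction work.
      cases j with
      | zero => simp [geomPMF, hasSum_zero]
      | succ j => exact (ih e' (by simp only at hx; omega)).mul_left _
    have hshift : ∀ r, p * (1 - p) ^ (r + 1) * geomConv a (r + 1) e =
        ∑ x ∈ Finset.HasAntidiagonal.antidiagonal e,
          (1 - p) * geomPMF a x.1 * (p * (1 - p) ^ r * geomConv a r x.2) := fun r => by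
      rw [geomConv, Finset.mul_sum]
      exact Finset.sum_congr rfl fun x _ => by ring
    have hs := hasSum_sum hterm
    simp only [← hshift] at hs
    have h0 := (hasSum_nat_add_iff (f := fun r => p * (1 - p) ^ r * geomConv a r e) 1).1 hs
    convert! h0 using 1
    cases e with
    | zero => simp [stepPMF, geomConv, geomPMF]
    | succ e =>
      rw [Finset.Nat.sum_antidiagonal_succ]
      simp only [geomPMF, mul_assoc (1 - p), ← Finset.mul_sum]
      rw [sum_antidiagonal_geometric_mul_stepPMF hd]
      simp [stepPMF, geomConv]
      ring

lemma geomPMF_nonneg {a : ℝ} (ha : 0 ≤ a) (ha1 : a ≤ 1) (j : ℕ) : 0 ≤ geomPMF a j := by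
  cases j with
  | zero => exact le_rfl
  | succ j => have := sub_nonneg.2 ha1; simp only [geomPMF]; positivity

lemma geomConv_nonneg {a : ℝ} (ha : 0 ≤ a) (ha1 : a ≤ 1) (r e : ℕ) : 0 ≤ geomConv a r e := by
  induction r generalizing e with
  | zero => simp only [geomConv]; split_ifs <;> norm_num
  | succ r ih => exact Finset.sum_nonneg fun x _ => mul_nonneg (geomPMF_nonneg ha ha1 _) (ih _)

/-- Summing an affine recursion with contraction factor `p`. -/
lemma hasSum_of_affine_recursion {p G : ℝ} {f g : ℕ → ℝ} (hp1 : p < 1)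
    (hf : ∀ m, 0 ≤ f m) (hg : HasSum g G) (hg0 : ∀ m, 0 ≤ g m)
    (hrec : ∀ m, f (m + 1) = p * f m + g m) : HasSum f ((f 0 + G) / (1 - p)) := by
  have hp' : 0 < 1 - p := sub_pos.2 hp1
  have hsum : Summable f := by
    -- The partial sums `s` satisfy `s ≤ f 0 + p * s + G`.
    refine summable_of_sum_range_le hf (c := (f 0 + G) / (1 - p)) fun N => ?_
    rw [le_div_iff₀ hp']
    have h1 : ∑ m ∈ Finset.range (N + 1), f m
        = p * ∑ m ∈ Finset.range N, f m + ∑ m ∈ Finset.range N, g m + f 0 := by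
      rw [Finset.sum_range_succ']
      simp only [hrec, Finset.sum_add_distrib, Finset.mul_sum]
    have h2 := sum_le_hasSum (Finset.range N) (fun m _ => hg0 m) hg
    rw [Finset.sum_range_succ] at h1
    have := hf N
    linarith
  have h := (hasSum_nat_add_iff (f := f) 1).1
    (by simpa only [hrec] using (hsum.hasSum.mul_left p).add hg)
  have heq := hsum.hasSum.unique h
  simp only [Finset.sum_range_one] at heq
  have hval : (f 0 + G) / (1 - p) = ∑' m, f m := by
    rw [div_eq_iff hp'.ne']
    linarith
  rw [hval]
  exact hsum.hasSum

/-- The renewal function of the random walk with steps `stepPMF p d`: the expected number of visits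
to each level. -/
noncomputable def renewal (p d : ℝ) (i : ℕ) : ℝ :=
  if i = 0 then 1 / (1 - p) else (1 - d) / (1 - p)

lemma sum_antidiagonal_renewal_mul_pow (p d : ℝ) (i : ℕ) :
    ∑ x ∈ Finset.HasAntidiagonal.antidiagonal i, renewal p d x.1 * d ^ x.2 = 1 / (1 - p) := by
  induction i with
  | zero => simp [renewal]
  | succ i ih =>
    rw [Finset.Nat.sum_antidiagonal_succ']
    simp only [pow_succ, ← mul_assoc, ← Finset.sum_mul, ih]
    simp [renewal]
    ring

lemma hasSum_renewal {p d : ℝ} (hp : 0 ≤ p) (hp1 : p < 1) (hd : 0 ≤ d) (hd1 : d ≤ 1)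
    {f : ℕ → ℕ → ℝ} (hf : ∀ m i, 0 ≤ f m i) (hf0 : ∀ i, f 0 i = if i = 0 then 1 else 0)
    (hrec : ∀ m i, f (m + 1) i =
      ∑ x ∈ Finset.HasAntidiagonal.antidiagonal i, f m x.1 * stepPMF p d x.2) (i : ℕ) :
    HasSum (fun m => f m i) (renewal p d i) := by
  induction i using Nat.strong_induction_on with
  | _ i ih =>
    cases i with
    | zero =>
      have h := hasSum_of_affine_recursion (f := fun m => f m 0) hp1 (fun m => hf m 0)
        hasSum_zero (fun _ => le_rfl) (fun m => by simp [hrec, stepPMF, mul_comm])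
      simpa [hf0, renewal] using h
    | succ i =>
      have hG : HasSum (fun m => ∑ x ∈ Finset.HasAntidiagonal.antidiagonal i,
          f m x.1 * stepPMF p d (x.2 + 1)) (1 - d) := by
        have h1 := hasSum_sum (s := Finset.HasAntidiagonal.antidiagonal i)
          (f := fun x m => f m x.1 * stepPMF p d (x.2 + 1)) fun x hx =>
            (ih x.1 (by have := Finset.HasAntidiagonal.mem_antidiagonal.1 hx; omega)).mul_right
              (stepPMF p d (x.2 + 1))
        convert h1 using 1
        have h2 : ∀ x : ℕ × ℕ, renewal p d x.1 * stepPMF p d (x.2 + 1) =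
            (1 - p) * (1 - d) * (renewal p d x.1 * d ^ x.2) := fun x => by
          simp only [stepPMF]; ring
        simp only [h2, ← Finset.mul_sum, sum_antidiagonal_renewal_mul_pow]
        have : 1 - p ≠ 0 := (sub_pos.2 hp1).ne'
        field_simp
      have h := hasSum_of_affine_recursion (f := fun m => f m (i + 1)) hp1 (fun m => hf m _) hG
        (fun m => Finset.sum_nonneg fun x _ =>
          mul_nonneg (hf m _) (stepPMF_nonneg hp hp1.le hd hd1 _))
        (fun m => by
          rw [hrec, Finset.Nat.sum_antidiagonal_succ']
          simp only [stepPMF, mul_comm])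
      simpa [hf0, renewal] using h

/-- The overshoot of a level `c ≥ 1` by the random walk is geometric: memorylessness of the
geometric law. -/
lemma sum_range_renewal_mul_stepPMF {p d : ℝ} (hp1 : p < 1) {c j : ℕ} (hc : 1 ≤ c) (hj : c ≤ j) :
    ∑ i ∈ Finset.range c, renewal p d i * stepPMF p d (j - i) = (1 - d) * d ^ (j - c) := by
  obtain ⟨c, rfl⟩ : ∃ c', c = c' + 1 := ⟨c - 1, by omega⟩
  have h1 := sum_antidiagonal_renewal_mul_pow p d c
  rw [Finset.Nat.sum_antidiagonal_eq_sum_range_succ (fun i k => renewal p d i * d ^ k)] at h1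
  have h2 : ∀ i ∈ Finset.range (c + 1), renewal p d i * stepPMF p d (j - i) =
      (1 - p) * (1 - d) * d ^ (j - (c + 1)) * (renewal p d i * d ^ (c - i)) := by
    intro i hi
    rw [Finset.mem_range] at hi
    obtain ⟨e, he⟩ : ∃ e, j - i = e + 1 := ⟨j - i - 1, by omega⟩
    have he' : e = (j - (c + 1)) + (c - i) := by omega
    rw [he]
    simp only [stepPMF]
    rw [he', pow_add]
    ring
  rw [Finset.sum_congr rfl h2, ← Finset.mul_sum, h1]
  have : 1 - p ≠ 0 := (sub_pos.2 hp1).ne'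
  field_simp

/-- Summation by parts, together with `erlangCDF_succ`. -/
lemma sum_geometric_mul_erlangCDF {d : ℝ} (hd : d ≠ 0) (x : ℝ) (c k : ℕ) :
    ∑ j ∈ Finset.Ico (c + 1) (c + 1 + k), (1 - d) * d ^ (j - (c + 1)) * erlangCDF j x =
      erlangCDF c x
        - Real.exp (-x) * (∑ i ∈ Finset.Ico c (c + k), (d * x) ^ i / (i ! : ℝ)) / d ^ c
        - d ^ k * erlangCDF (c + k) x := by
  induction k with
  | zero => simp
  | succ k ih =>
    rw [← add_assoc, Finset.sum_Ico_succ_top (by omega), ih, ← add_assoc,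
      Finset.sum_Ico_succ_top (by omega)]
    have h1 : c + 1 + k = c + k + 1 := by omega
    have h2 : c + 1 + k - (c + 1) = k := by omega
    rw [h2, h1, erlangCDF_succ]
    have h3 : (d * x) ^ (c + k) = d ^ c * d ^ k * x ^ (c + k) := by
      rw [mul_pow, pow_add d]
    have h4 : d ^ c ≠ 0 := pow_ne_zero _ hd
    rw [h3]
    field_simp
    ring

/-! ### First passage indices -/

lemma firstIndex_lt_iff (p : ℕ → Prop) (x : ℕ∞) :
    firstIndex p < x ↔ ∃ m, p m ∧ (m : ℕ∞) < x := by
  simp [firstIndex, sInf_lt_iff]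

lemma lt_firstIndex_iff {p : ℕ → Prop} (hp : ∀ m m', m ≤ m' → p m → p m') (m : ℕ) :
    (m : ℕ∞) < firstIndex p ↔ ¬ p m := by
  rw [← not_le, not_iff_not]
  refine ⟨fun h => ?_, fun h => sInf_le ⟨m, h, rfl⟩⟩
  have h' : firstIndex p < ((m + 1 : ℕ) : ℕ∞) :=
    lt_of_le_of_lt h (by exact_mod_cast Nat.lt_succ_self m)
  obtain ⟨j, hj, hjm⟩ := (firstIndex_lt_iff p _).1 h'
  rw [Nat.cast_lt] at hjm
  exact hp j m (by omega) hj

/-- For monotone processes the first passage event splits according to the last index before the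
passage. -/
lemma firstIndex_lt_min_iff {N : ℕ → ℕ} {W : ℕ → ℝ} (hN : Monotone N) (hW : Monotone W)
    {c C : ℕ} {V : ℝ} (h0 : N 0 < c) :
    firstIndex (fun m => c ≤ N m) < min (firstIndex fun m => C ≤ N m) (firstIndex fun m => V < W m)
      ↔ ∃ m, N m < c ∧ c ≤ N (m + 1) ∧ N (m + 1) < C ∧ W (m + 1) ≤ V := by
  classical
  have h1 := lt_firstIndex_iff (p := fun m => C ≤ N m) fun m m' h hm => hm.trans (hN h)
  have h2 := lt_firstIndex_iff (p := fun m => V < W m) fun m m' h hm => hm.trans_le (hW h)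
  simp only [firstIndex_lt_iff _ (min _ _), lt_min_iff, h1, h2, not_le, not_lt]
  constructor
  · rintro ⟨m, hcm, hC, hV⟩
    have hex : ∃ m, c ≤ N m := ⟨m, hcm⟩
    obtain ⟨m', hm'⟩ : ∃ m', Nat.find hex = m' + 1 := by
      refine ⟨Nat.find hex - 1, ?_⟩
      have : Nat.find hex ≠ 0 := fun h => by
        have := Nat.find_spec hex
        rw [h] at this
        omega
      omega
    have hle : m' + 1 ≤ m := hm' ▸ Nat.find_min' hex hcm
    refine ⟨m', not_le.1 (Nat.find_min hex (by omega)), hm' ▸ Nat.find_spec hex,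
      (hN hle).trans_lt hC, (hW hle).trans hV⟩
  · rintro ⟨m, -, h⟩
    exact ⟨m + 1, h⟩

/-! ### Attack counts combined with the marks -/

section

variable {Ω : Type*}

/-- The marks of a realization: the numbers of nodes and their weights. -/
def marks (n : ℕ → Ω → ℕ) (w : ℕ → ℕ → Ω → ℝ) (ω : Ω) : (ℕ → ℕ) × (ℕ × ℕ → ℝ) :=
  (fun k => n k ω, fun p => w p.1 p.2 ω)

/-- The number of nodes destroyed by the first `k` attacks. -/
def totalNodes (k : ℕ) (z : (ℕ → ℕ) × (ℕ × ℕ → ℝ)) : ℕ := ∑ l ∈ Finset.range k, z.1 l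

/-- The weight of the nodes destroyed by the first `k` attacks. -/
def totalWeight (k : ℕ) (z : (ℕ → ℕ) × (ℕ × ℕ → ℝ)) : ℝ :=
  ∑ l ∈ Finset.range k, ∑ j ∈ Finset.range (z.1 l), z.2 (l, j)

lemma measurable_totalNodes (k : ℕ) : Measurable (totalNodes k) := by
  unfold totalNodes; fun_prop

lemma measurable_totalWeight (k : ℕ) : Measurable (totalWeight k) :=
  measurable_sum_range_sum_range k

lemma totalNodes_mono {k l : ℕ} (h : k ≤ l) (z : (ℕ → ℕ) × (ℕ × ℕ → ℝ)) :
    totalNodes k z ≤ totalNodes l z :=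
  Finset.sum_le_sum_of_subset (Finset.range_mono h)

lemma totalWeight_mono {k l : ℕ} (h : k ≤ l) {z : (ℕ → ℕ) × (ℕ × ℕ → ℝ)}
    (hz : ∀ p, 0 ≤ z.2 p) : totalWeight k z ≤ totalWeight l z :=
  Finset.sum_le_sum_of_subset_of_nonneg (Finset.range_mono h) fun _ _ _ =>
    Finset.sum_nonneg fun _ _ => hz _

lemma nodesLost_eq_totalNodes {t Δ : ℕ → Ω → ℝ} (n : ℕ → Ω → ℕ) (w : ℕ → ℕ → Ω → ℝ) {ω : Ω}
    (hω : IsRegularPath fun k => t k ω) {m k : ℕ} (hk : ω ∈ countEvent t Δ m k) :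
    nodesLost t Δ n m ω = totalNodes k (marks n w ω) := by
  rw [nodesLost, hω.setOf_mem_Icc hk, finsum_mem_coe_finset]
  rfl

lemma weightLost_eq_totalWeight {t Δ : ℕ → Ω → ℝ} (n : ℕ → Ω → ℕ) (w : ℕ → ℕ → Ω → ℝ) {ω : Ω}
    (hω : IsRegularPath fun k => t k ω) {m k : ℕ} (hk : ω ∈ countEvent t Δ m k) :
    weightLost t Δ n w m ω = totalWeight k (marks n w ω) := by
  rw [weightLost, hω.setOf_mem_Icc hk, finsum_mem_coe_finset]
  rfl

/-- The almost sure properties of a realization of the model used below: a regular path of attack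
times, nonnegative inter-observation times and nonnegative weights. -/
structure IsRegularOutcome (t Δ : ℕ → Ω → ℝ) (w : ℕ → ℕ → Ω → ℝ) (ω : Ω) : Prop where
  path : IsRegularPath fun k => t k ω
  interarrival_nonneg : ∀ i, 0 ≤ Δ i ω
  weight_nonneg : ∀ k j, 0 ≤ w k j ω

namespace IsRegularOutcome

variable {t Δ : ℕ → Ω → ℝ} {n : ℕ → Ω → ℕ} {w : ℕ → ℕ → Ω → ℝ} {ω : Ω}

lemma exists_countEvent (h : IsRegularOutcome t Δ w ω) (m : ℕ) :
    ∃ k r, ω ∈ countEvent t Δ m k ∩ countEvent t Δ (m + 1) (k + r) := by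
  obtain ⟨k, hk⟩ := h.path.exists_mem_countSet (obsTime Δ m ω)
  obtain ⟨l, hl⟩ := h.path.exists_mem_countSet (obsTime Δ (m + 1) ω)
  have hle : obsTime Δ m ω ≤ obsTime Δ (m + 1) ω := by
    simp only [obsTime, Finset.sum_range_succ]
    linarith [h.interarrival_nonneg m]
  have hkl := h.path.le_of_mem_countSet hle hk hl
  exact ⟨k, l - k, hk, by rwa [Nat.add_sub_cancel' hkl]⟩

lemma monotone_nodesLost (h : IsRegularOutcome t Δ w ω) :
    Monotone fun m => nodesLost t Δ n m ω := by
  refine monotone_nat_of_le_succ fun m => ?_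
  obtain ⟨k, r, hk, hr⟩ := h.exists_countEvent m
  rw [nodesLost_eq_totalNodes n w h.path hk, nodesLost_eq_totalNodes n w h.path hr]
  exact totalNodes_mono (Nat.le_add_right k r) _

lemma monotone_weightLost (h : IsRegularOutcome t Δ w ω) :
    Monotone fun m => weightLost t Δ n w m ω := by
  refine monotone_nat_of_le_succ fun m => ?_
  obtain ⟨k, r, hk, hr⟩ := h.exists_countEvent m
  rw [weightLost_eq_totalWeight n w h.path hk, weightLost_eq_totalWeight n w h.path hr]
  exact totalWeight_mono (Nat.le_add_right k r) fun p => h.weight_nonneg p.1 p.2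

/-- Events about `N_m`, `N_{m+1}` and `W_{m+1}` in terms of the numbers of attacks. -/
lemma exists_countEvent_and_iff (h : IsRegularOutcome t Δ w ω) (m : ℕ) (Q : ℕ → ℕ → ℝ → Prop) :
    (∃ k r, ω ∈ countEvent t Δ m k ∩ countEvent t Δ (m + 1) (k + r) ∧
      Q (totalNodes k (marks n w ω)) (totalNodes (k + r) (marks n w ω))
        (totalWeight (k + r) (marks n w ω))) ↔
      Q (nodesLost t Δ n m ω) (nodesLost t Δ n (m + 1) ω) (weightLost t Δ n w (m + 1) ω) := by
  constructor
  · rintro ⟨k, r, ⟨hk, hr⟩, hQ⟩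
    rwa [nodesLost_eq_totalNodes n w h.path hk, nodesLost_eq_totalNodes n w h.path hr,
      weightLost_eq_totalWeight n w h.path hr]
  · intro hQ
    obtain ⟨k, r, hk, hr⟩ := h.exists_countEvent m
    rw [nodesLost_eq_totalNodes n w h.path hk, nodesLost_eq_totalNodes n w h.path hr,
      weightLost_eq_totalWeight n w h.path hr] at hQ
    exact ⟨k, r, ⟨hk, hr⟩, hQ⟩

end IsRegularOutcome

namespace IsModel

variable [MeasurableSpace Ω] {P : Measure Ω}
  {t Δ : ℕ → Ω → ℝ} {n : ℕ → Ω → ℕ} {w : ℕ → ℕ → Ω → ℝ} {lam mu a xi : ℝ}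

lemma ae_isRegularOutcome (h : IsModel P t Δ n w lam mu a xi) :
    ∀ᵐ ω ∂P, IsRegularOutcome t Δ w ω := by
  have hw : ∀ᵐ ω ∂P, ∀ k j, 0 ≤ w k j ω := ae_all_iff.2 fun k => ae_all_iff.2 fun j =>
    ae_nonneg_of_hasLaw_expMeasure (h.law_w k j)
  filter_upwards [h.poisson.ae_isRegularPath, h.ae_nonneg_interarrival, hw] with ω h1 h2 h3
  exact ⟨h1, h2, h3⟩

lemma measurable_marks (h : IsModel P t Δ n w lam mu a xi) : Measurable (marks n w) :=
  (measurable_pi_lambda _ h.measurable_n).prodMk (measurable_pi_lambda _ fun p =>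
    h.measurable_w p.1 p.2)

/-- The attack and observation times are independent of the marks. -/
lemma measure_countEvent_inter_marks (h : IsModel P t Δ n w lam mu a xi) (m k l : ℕ)
    {B : Set ((ℕ → ℕ) × (ℕ × ℕ → ℝ))} (hB : MeasurableSet B) :
    P (countEvent t Δ m k ∩ countEvent t Δ (m + 1) l ∩ marks n w ⁻¹' B) =
      P (countEvent t Δ m k ∩ countEvent t Δ (m + 1) l) * P (marks n w ⁻¹' B) := by
  have hA : ∀ m k, MeasurableSet {y : (ℕ → ℝ) × (ℕ → ℝ) |
      (∑ i ∈ Finset.range m, y.2 i, y.1) ∈ countSet k} := fun m k =>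
    (by fun_prop : Measurable fun y : (ℕ → ℝ) × (ℕ → ℝ) => (∑ i ∈ Finset.range m, y.2 i, y.1))
      (measurableSet_countSet k)
  exact h.indep_times_marks.measure_inter_preimage_eq_mul _ _ ((hA m k).inter (hA (m + 1) l)) hB

variable [IsProbabilityMeasure P]

/-- If the probabilities of events on the marks factor in the number `k` of attacks up to time
`τ_m` and the number `r` of attacks between `τ_m` and `τ_{m+1}`, then the probability of the mixed
event factors too. -/
lemma measure_mixed_event (h : IsModel P t Δ n w lam mu a xi) (hlam : 0 < lam) (hmu : 0 < mu)
    (m : ℕ) (Q : ℕ → ℕ → ℝ → Prop) (hQ : ∀ x y, MeasurableSet {v | Q x y v})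
    {α β : ℕ → ℝ} {γ σ : ℝ} (hα : ∀ k, 0 ≤ α k) (hβ : ∀ r, 0 ≤ β r)
    (hmarks : ∀ k r, P.real {ω | Q (totalNodes k (marks n w ω)) (totalNodes (k + r) (marks n w ω))
      (totalWeight (k + r) (marks n w ω))} = α k * β r * γ)
    (hσ : HasSum (fun r => mu / (lam + mu) * (lam / (lam + mu)) ^ r * β r) σ) :
    NullMeasurableSet {ω | Q (nodesLost t Δ n m ω) (nodesLost t Δ n (m + 1) ω)
      (weightLost t Δ n w (m + 1) ω)} P ∧
    P {ω | Q (nodesLost t Δ n m ω) (nodesLost t Δ n (m + 1) ω) (weightLost t Δ n w (m + 1) ω)} =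
      (∑' k, P (countEvent t Δ m k) * ENNReal.ofReal (α k)) * ENNReal.ofReal σ *
        ENNReal.ofReal γ := by
  set B : ℕ × ℕ → Set ((ℕ → ℕ) × (ℕ × ℕ → ℝ)) := fun x =>
    {z | Q (totalNodes x.1 z) (totalNodes (x.1 + x.2) z) (totalWeight (x.1 + x.2) z)} with hB
  have hBm : ∀ x, MeasurableSet (B x) := by
    intro x
    have hQm : MeasurableSet {y : (ℕ × ℕ) × ℝ | Q y.1.1 y.1.2 y.2} := by
      have : {y : (ℕ × ℕ) × ℝ | Q y.1.1 y.1.2 y.2} =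
          ⋃ u : ℕ × ℕ, {u} ×ˢ {v | Q u.1 u.2 v} := by
        ext ⟨u, v⟩
        simp
      rw [this]
      exact MeasurableSet.iUnion fun u => (measurableSet_singleton u).prod (hQ u.1 u.2)
    exact (((measurable_totalNodes x.1).prodMk (measurable_totalNodes (x.1 + x.2))).prodMk
      (measurable_totalWeight (x.1 + x.2))) hQm
  set E : ℕ × ℕ → Set Ω := fun x =>
    countEvent t Δ m x.1 ∩ countEvent t Δ (m + 1) (x.1 + x.2) ∩ marks n w ⁻¹' B x with hE
  have hDm := measurableSet_countEvent h.poisson.measurable h.measurable_Δ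
  have hEm : ∀ x, MeasurableSet (E x) := fun x =>
    ((hDm m x.1).inter (hDm (m + 1) (x.1 + x.2))).inter (h.measurable_marks (hBm x))
  have hae : (⋃ x, E x) =ᵐ[P] {ω | Q (nodesLost t Δ n m ω) (nodesLost t Δ n (m + 1) ω)
      (weightLost t Δ n w (m + 1) ω)} := by
    filter_upwards [h.ae_isRegularOutcome] with ω hω
    refine propext (Iff.trans ?_ (hω.exists_countEvent_and_iff m Q))
    change ω ∈ (⋃ x, E x) ↔ _
    rw [mem_iUnion, Prod.exists]
    rfl
  refine ⟨(MeasurableSet.iUnion hEm).nullMeasurableSet.congr hae, ?_⟩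
  -- The attack counts are unique only on regular paths, hence the disjointness almost everywhere.
  have hdisj : Pairwise fun x y => AEDisjoint P (E x) (E y) := by
    intro x y hxy
    refine measure_mono_null (t := {ω | ¬ IsRegularPath fun k => t k ω}) (fun ω hω hreg => ?_)
      (ae_iff.1 h.poisson.ae_isRegularPath)
    obtain ⟨⟨⟨h1, h2⟩, -⟩, ⟨⟨h3, h4⟩, -⟩⟩ := hω
    have e1 : x.1 = y.1 := hreg.eq_of_mem_countSet h1 h3
    have e2 : x.1 + x.2 = y.1 + y.2 := hreg.eq_of_mem_countSet h2 h4
    exact hxy (Prod.ext e1 (by omega))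
  have hσ' : ENNReal.ofReal σ =
      ∑' r, ENNReal.ofReal (mu / (lam + mu) * (lam / (lam + mu)) ^ r * β r) := by
    rw [← hσ.tsum_eq, ENNReal.ofReal_tsum_of_nonneg (fun r => mul_nonneg (by positivity) (hβ r))
      hσ.summable]
  have hterm : ∀ k r, P (E (k, r)) = P (countEvent t Δ m k) * ENNReal.ofReal (α k) *
      ENNReal.ofReal (mu / (lam + mu) * (lam / (lam + mu)) ^ r * β r) * ENNReal.ofReal γ := by
    intro k r
    have h1 := h.measure_countEvent_inter_marks m k (k + r) (hBm (k, r))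
    have h2 : P (countEvent t Δ m k ∩ countEvent t Δ (m + 1) (k + r)) = P (countEvent t Δ m k) *
        ENNReal.ofReal (mu / (lam + mu) * (lam / (lam + mu)) ^ r) := by
      rw [← ofReal_measureReal, h.measureReal_countEvent_inter hlam hmu m k r,
        ENNReal.ofReal_mul measureReal_nonneg, ofReal_measureReal]
    have h3 : P (marks n w ⁻¹' B (k, r)) = ENNReal.ofReal (α k) * ENNReal.ofReal (β r) *
        ENNReal.ofReal γ := by
      rw [← ENNReal.ofReal_mul (hα k), ← ENNReal.ofReal_mul (mul_nonneg (hα k) (hβ r)),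
        ← hmarks k r, ofReal_measureReal]
      rfl
    rw [ENNReal.ofReal_mul (by positivity), show P (E (k, r)) = _ from h1, h2, h3]
    ring
  rw [← measure_congr hae, measure_iUnion₀ hdisj fun x => (hEm x).nullMeasurableSet,
    ENNReal.tsum_prod (f := fun k r => P (E (k, r)))]
  simp only [hterm, ENNReal.tsum_mul_right, ENNReal.tsum_mul_left, ← hσ']

end IsModel

end

/-! ### The first passage probability -/

section

variable {Ω : Type*} [MeasurableSpace Ω] {P : Measure Ω} [IsProbabilityMeasure P]

lemma one_sub_dFun_zero {lam mu : ℝ} (hlam : 0 < lam) (hmu : 0 < mu) (a : ℝ) :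
    1 - dFun lam mu a 0 = a * (mu / (lam + mu)) := by
  have : lam + mu ≠ 0 := by positivity
  rw [dFun, add_zero, add_zero]
  field_simp
  ring

lemma dFun_zero_pos {lam mu a : ℝ} (hlam : 0 < lam) (hmu : 0 < mu) (ha1 : a ≤ 1) :
    0 < dFun lam mu a 0 := by
  have := sub_nonneg.2 ha1
  rw [dFun]
  positivity

lemma hasSum_stepPMF {lam mu : ℝ} (hlam : 0 < lam) (hmu : 0 < mu) (a : ℝ) (e : ℕ) :
    HasSum (fun r => mu / (lam + mu) * (lam / (lam + mu)) ^ r * geomConv a r e)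
      (stepPMF (mu / (lam + mu)) (dFun lam mu a 0) e) := by
  have hq : lam / (lam + mu) = 1 - mu / (lam + mu) := by field_simp; ring
  rw [hq]
  exact hasSum_geomConv (one_sub_dFun_zero hlam hmu a) e

namespace IsModel

variable {t Δ : ℕ → Ω → ℝ} {n : ℕ → Ω → ℕ} {w : ℕ → ℕ → Ω → ℝ} {lam mu a xi : ℝ}
  (h : IsModel P t Δ n w lam mu a xi) (hlam : 0 < lam) (hmu : 0 < mu)
  (ha : 0 < a) (ha1 : a ≤ 1)
include h hlam hmu ha ha1

lemma measure_nodesLost_eq (m i : ℕ) :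
    NullMeasurableSet {ω | nodesLost t Δ n m ω = i} P ∧
    P {ω | nodesLost t Δ n m ω = i} =
      ∑' k, P (countEvent t Δ m k) * ENNReal.ofReal (geomConv a k i) := by
  have hp : lam / (lam + mu) < 1 := by rw [div_lt_one] <;> linarith
  have hσ : HasSum (fun r => mu / (lam + mu) * (lam / (lam + mu)) ^ r * 1) 1 := by
    have hg := (hasSum_geometric_of_lt_one (by positivity) hp).mul_left (mu / (lam + mu))
    have hq : 1 - lam / (lam + mu) = mu / (lam + mu) := by field_simp; ring
    rw [hq, mul_inv_cancel₀ (by positivity)] at hg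
    simpa using hg
  have hm := h.measure_mixed_event hlam hmu m (fun x _ _ => x = i)
    (fun x y => MeasurableSet.const _) (α := fun k => geomConv a k i) (β := fun _ => 1) (γ := 1)
    (fun k => geomConv_nonneg ha.le ha1 k i) (fun _ => zero_le_one) (fun k r => by
      have := measureReal_sum_eq_geomConv ha ha1 h.measurable_n h.law_n h.indep_n
        (Finset.range k) i
      rw [Finset.card_range] at this
      rw [mul_one, mul_one]
      exact this) hσ
  simpa using hm

lemma measure_nodesLost_eq_and_eq (m i e : ℕ) :
    NullMeasurableSet {ω | nodesLost t Δ n m ω = i ∧ nodesLost t Δ n (m + 1) ω = i + e} P ∧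
    P {ω | nodesLost t Δ n m ω = i ∧ nodesLost t Δ n (m + 1) ω = i + e} =
      P {ω | nodesLost t Δ n m ω = i} *
        ENNReal.ofReal (stepPMF (mu / (lam + mu)) (dFun lam mu a 0) e) := by
  have hm := h.measure_mixed_event hlam hmu m (fun x y _ => x = i ∧ y = i + e)
    (fun x y => MeasurableSet.const _) (α := fun k => geomConv a k i)
    (β := fun r => geomConv a r e) (γ := 1)
    (fun k => geomConv_nonneg ha.le ha1 k i) (fun r => geomConv_nonneg ha.le ha1 r e) (fun k r => by
      rw [mul_one]
      exact measureReal_sum_range_and_sum_range_add ha ha1 h.measurable_n h.law_n h.indep_n k r i e)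
    (hasSum_stepPMF hlam hmu a e)
  rw [(h.measure_nodesLost_eq hlam hmu ha ha1 m i).2]
  simpa using hm

lemma measure_nodesLost_eq_and_eq_and_weightLost_le (hxi : 0 < xi) {V : ℝ} (hV : 0 ≤ V)
    (m i e : ℕ) :
    NullMeasurableSet {ω | nodesLost t Δ n m ω = i ∧ nodesLost t Δ n (m + 1) ω = i + e ∧
      weightLost t Δ n w (m + 1) ω ≤ V} P ∧
    P {ω | nodesLost t Δ n m ω = i ∧ nodesLost t Δ n (m + 1) ω = i + e ∧
      weightLost t Δ n w (m + 1) ω ≤ V} =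
      P {ω | nodesLost t Δ n m ω = i} *
        ENNReal.ofReal (stepPMF (mu / (lam + mu)) (dFun lam mu a 0) e) *
        ENNReal.ofReal (erlangCDF (i + e) (xi * V)) := by
  have hm := h.measure_mixed_event hlam hmu m (fun x y v => x = i ∧ y = i + e ∧ v ≤ V)
    (fun x y => (MeasurableSet.const _).inter ((MeasurableSet.const _).inter measurableSet_Iic))
    (α := fun k => geomConv a k i)
    (β := fun r => geomConv a r e) (γ := erlangCDF (i + e) (xi * V))
    (fun k => geomConv_nonneg ha.le ha1 k i) (fun r => geomConv_nonneg ha.le ha1 r e)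
    (fun k r => measureReal_marks ha ha1 hxi hV h.measurable_n h.law_n h.indep_n h.measurable_w
      h.law_w h.indep_w h.indep_n_w k r i e)
    (hasSum_stepPMF hlam hmu a e)
  rw [(h.measure_nodesLost_eq hlam hmu ha ha1 m i).2]
  exact hm

lemma measureReal_nodesLost_zero_eq (i : ℕ) :
    P.real {ω | nodesLost t Δ n 0 ω = i} = if i = 0 then 1 else 0 := by
  have hD : ∀ k, P (countEvent t Δ 0 k) = if k = 0 then 1 else 0 := by
    intro k
    rw [h.measure_countEvent hlam.le]
    cases k <;> simp [obsTime, poissonPMF]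
  rw [measureReal_def, (h.measure_nodesLost_eq hlam hmu ha ha1 0 i).2,
    tsum_eq_single 0 fun k hk => by simp [hD, hk]]
  by_cases hi : i = 0 <;> simp [hD, geomConv, hi]

lemma ae_nodesLost_zero_eq : ∀ᵐ ω ∂P, nodesLost t Δ n 0 ω = 0 := by
  have h0 := h.measureReal_nodesLost_zero_eq hlam hmu ha ha1 0
  have hm := (h.measure_nodesLost_eq hlam hmu ha ha1 0 0).1
  rw [ae_iff]
  have h1 : P {ω | nodesLost t Δ n 0 ω = 0} = 1 := by
    rw [← ofReal_measureReal, h0]; simp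
  exact (prob_compl_eq_zero_iff₀ hm).2 h1

/-- The Chapman-Kolmogorov equation of the random walk `N`. -/
lemma measureReal_nodesLost_succ_eq (m j : ℕ) :
    P.real {ω | nodesLost t Δ n (m + 1) ω = j} =
      ∑ x ∈ Finset.HasAntidiagonal.antidiagonal j, P.real {ω | nodesLost t Δ n m ω = x.1} *
        stepPMF (mu / (lam + mu)) (dFun lam mu a 0) x.2 := by
  set E : ℕ × ℕ → Set Ω := fun x =>
    {ω | nodesLost t Δ n m ω = x.1 ∧ nodesLost t Δ n (m + 1) ω = x.1 + x.2} with hE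
  have hE' := fun x : ℕ × ℕ => h.measure_nodesLost_eq_and_eq hlam hmu ha ha1 m x.1 x.2
  have hae : {ω | nodesLost t Δ n (m + 1) ω = j} =ᵐ[P]
      (⋃ x ∈ Finset.HasAntidiagonal.antidiagonal j, E x : Set Ω) := by
    filter_upwards [h.ae_isRegularOutcome] with ω hω
    refine propext ?_
    change nodesLost t Δ n (m + 1) ω = j ↔
      ω ∈ (⋃ x ∈ Finset.HasAntidiagonal.antidiagonal j, E x : Set Ω)
    have hmono : nodesLost t Δ n m ω ≤ nodesLost t Δ n (m + 1) ω :=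
      hω.monotone_nodesLost (Nat.le_succ m)
    simp only [mem_iUnion, Finset.HasAntidiagonal.mem_antidiagonal, exists_prop, Prod.exists, hE,
      mem_ofPred_eq]
    constructor
    · intro hj
      exact ⟨nodesLost t Δ n m ω, j - nodesLost t Δ n m ω, by omega, rfl, by omega⟩
    · rintro ⟨x, y, hxy, -, h2⟩
      omega
  have hd0 := (dFun_zero_pos hlam hmu ha1).le
  rw [measureReal_congr hae, measureReal_def, measure_biUnion_finset₀ _ fun x _ => (hE' x).1,
    ENNReal.toReal_sum fun _ _ => measure_ne_top _ _]
  · refine Finset.sum_congr rfl fun x _ => ?_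
    have hnn : 0 ≤ stepPMF (mu / (lam + mu)) (dFun lam mu a 0) x.2 :=
      (hasSum_stepPMF hlam hmu a x.2).nonneg fun r =>
        mul_nonneg (by positivity) (geomConv_nonneg ha.le ha1 r x.2)
    rw [(hE' x).2, ENNReal.toReal_mul, ENNReal.toReal_ofReal hnn]
    rfl
  · intro x _ y _ hxy
    refine Disjoint.aedisjoint (Set.disjoint_left.2 ?_)
    rintro ω ⟨h1, h2⟩ ⟨h3, h4⟩
    exact hxy (Prod.ext (h1.symm.trans h3) (by omega))

/-- The probability that the node level `c` is crossed strictly before the node level `C` and the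
weight level `V`. -/
lemma measureReal_firstIndex_lt_min (hxi : 0 < xi) {V : ℝ} (hV : 0 ≤ V) {c C : ℕ} (hc : 1 ≤ c) :
    P.real {ω | firstIndex (fun m => c ≤ nodesLost t Δ n m ω) <
        min (firstIndex fun m => C ≤ nodesLost t Δ n m ω)
          (firstIndex fun m => V < weightLost t Δ n w m ω)} =
      ∑ j ∈ Finset.Ico c C, (1 - dFun lam mu a 0) * dFun lam mu a 0 ^ (j - c) *
        erlangCDF j (xi * V) := by
  set p := mu / (lam + mu) with hp
  set d := dFun lam mu a 0 with hd
  have hp0 : 0 ≤ p := by positivity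
  have hp1 : p < 1 := by rw [hp, div_lt_one] <;> linarith
  have hd0 : 0 ≤ d := (dFun_zero_pos hlam hmu ha1).le
  have hd1 : d ≤ 1 := by
    have h1 : 1 - d = a * p := one_sub_dFun_zero hlam hmu a
    have : 0 ≤ a * p := by positivity
    linarith
  -- The pairs `(N_m, N_{m+1})` that are possible when `m` is the last index before the passage; the
  -- subtraction `x.2 - x.1` below is not truncated on them.
  set I : Finset (ℕ × ℕ) := Finset.range c ×ˢ Finset.Ico c C with hI
  set E : ℕ → ℕ × ℕ → Set Ω := fun m x => {ω | nodesLost t Δ n m ω = x.1 ∧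
    nodesLost t Δ n (m + 1) ω = x.1 + (x.2 - x.1) ∧ weightLost t Δ n w (m + 1) ω ≤ V} with hE
  have hE' := fun m (x : ℕ × ℕ) => h.measure_nodesLost_eq_and_eq_and_weightLost_le hlam hmu ha ha1
    hxi hV m x.1 (x.2 - x.1)
  have hadd : ∀ x ∈ I, x.1 + (x.2 - x.1) = x.2 := fun x hx => by
    simp only [hI, Finset.mem_product, Finset.mem_range, Finset.mem_Ico] at hx
    omega
  have hmem : ∀ m ω, ω ∈ (⋃ x ∈ I, E m x) ↔ nodesLost t Δ n m ω < c ∧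
      c ≤ nodesLost t Δ n (m + 1) ω ∧ nodesLost t Δ n (m + 1) ω < C ∧
      weightLost t Δ n w (m + 1) ω ≤ V := by
    intro m ω
    simp only [mem_iUnion, exists_prop]
    constructor
    · rintro ⟨x, hx, h1, h2, h3⟩
      rw [hadd x hx] at h2
      simp only [hI, Finset.mem_product, Finset.mem_range, Finset.mem_Ico] at hx
      exact ⟨by omega, by omega, by omega, h3⟩
    · rintro ⟨h1, h2, h3, h4⟩
      refine ⟨(nodesLost t Δ n m ω, nodesLost t Δ n (m + 1) ω), ?_, rfl, ?_, h4⟩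
      · simp only [hI, Finset.mem_product, Finset.mem_range, Finset.mem_Ico]
        exact ⟨h1, h2, h3⟩
      · dsimp only
        omega
  have hae : {ω | firstIndex (fun m => c ≤ nodesLost t Δ n m ω) <
        min (firstIndex fun m => C ≤ nodesLost t Δ n m ω)
          (firstIndex fun m => V < weightLost t Δ n w m ω)} =ᵐ[P]
      (⋃ m, ⋃ x ∈ I, E m x : Set Ω) := by
    filter_upwards [h.ae_isRegularOutcome, h.ae_nodesLost_zero_eq hlam hmu ha ha1] with ω hω h0
    refine propext (Iff.trans
      (firstIndex_lt_min_iff hω.monotone_nodesLost hω.monotone_weightLost (by omega)) ?_)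
    change _ ↔ ω ∈ (⋃ m, ⋃ x ∈ I, E m x : Set Ω)
    rw [mem_iUnion]
    simp only [hmem]
  have hnull : ∀ m, NullMeasurableSet (⋃ x ∈ I, E m x) P := fun m =>
    Finset.nullMeasurableSet_biUnion I fun x _ => (hE' m x).1
  have hdisj : Pairwise fun m m' => AEDisjoint P (⋃ x ∈ I, E m x) (⋃ x ∈ I, E m' x) := by
    have key : ∀ m m', m < m' → AEDisjoint P (⋃ x ∈ I, E m x) (⋃ x ∈ I, E m' x) := by
      intro m m' hmm
      refine measure_mono_null (t := {ω | ¬ IsRegularOutcome t Δ w ω}) (fun ω hω hreg => ?_)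
        (ae_iff.1 h.ae_isRegularOutcome)
      have h1 := (hmem m ω).1 hω.1
      have h2 := (hmem m' ω).1 hω.2
      have h3 : nodesLost t Δ n (m + 1) ω ≤ nodesLost t Δ n m' ω :=
        hreg.monotone_nodesLost (Nat.succ_le_of_lt hmm)
      omega
    intro m m' hmm
    rcases lt_or_gt_of_ne hmm with hlt | hlt
    · exact key m m' hlt
    · exact (key m' m hlt).symm
  have hrenew := hasSum_renewal hp0 hp1 hd0 hd1
    (f := fun m i => P.real {ω | nodesLost t Δ n m ω = i}) (fun _ _ => measureReal_nonneg)
    (h.measureReal_nodesLost_zero_eq hlam hmu ha ha1)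
    (h.measureReal_nodesLost_succ_eq hlam hmu ha ha1)
  have hEreal : ∀ m, ∀ x ∈ I, P.real (E m x) = P.real {ω | nodesLost t Δ n m ω = x.1} *
      (stepPMF p d (x.2 - x.1) * erlangCDF x.2 (xi * V)) := by
    intro m x hx
    rw [measureReal_def, (hE' m x).2, ENNReal.toReal_mul, ENNReal.toReal_mul,
      ENNReal.toReal_ofReal (stepPMF_nonneg hp0 hp1.le hd0 hd1 _), hadd x hx,
      ENNReal.toReal_ofReal (erlangCDF_nonneg _ (by positivity)), mul_assoc]
    rfl
  have hUreal : ∀ m, P.real (⋃ x ∈ I, E m x) = ∑ x ∈ I, P.real {ω | nodesLost t Δ n m ω = x.1} *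
      (stepPMF p d (x.2 - x.1) * erlangCDF x.2 (xi * V)) := by
    intro m
    rw [measureReal_def, measure_biUnion_finset₀ _ fun x _ => (hE' m x).1,
      ENNReal.toReal_sum fun _ _ => measure_ne_top _ _]
    · exact Finset.sum_congr rfl fun x hx => hEreal m x hx
    · intro x hx y hy hxy
      refine Disjoint.aedisjoint (Set.disjoint_left.2 ?_)
      rintro ω ⟨h1, h2, -⟩ ⟨h3, h4, -⟩
      rw [hadd x hx] at h2
      rw [hadd y hy] at h4
      exact hxy (Prod.ext (h1.symm.trans h3) (h2.symm.trans h4))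
  have hsum : HasSum (fun m => P.real (⋃ x ∈ I, E m x))
      (∑ x ∈ I, renewal p d x.1 * (stepPMF p d (x.2 - x.1) * erlangCDF x.2 (xi * V))) := by
    simp only [hUreal]
    exact hasSum_sum fun x _ => (hrenew x.1).mul_right _
  have htotal : P.real (⋃ m, ⋃ x ∈ I, E m x) = ∑' m, P.real (⋃ x ∈ I, E m x) := by
    rw [measureReal_def, measure_iUnion₀ hdisj hnull,
      ENNReal.tsum_toReal_eq fun m => measure_ne_top _ _]
    rfl
  rw [measureReal_congr hae, htotal, hsum.tsum_eq, hI, Finset.sum_product_right]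
  refine Finset.sum_congr rfl fun j hj => ?_
  simp only [← mul_assoc, ← Finset.sum_mul]
  rw [sum_range_renewal_mul_stepPMF hp1 hc (Finset.mem_Ico.1 hj).1]

/-- The same probability in closed form, for the levels `c + 1` and `C`. -/
lemma measureReal_firstIndex_lt_min_eq (hxi : 0 < xi) {V : ℝ} (hV : 0 ≤ V) {c C : ℕ}
    (hC : c + 1 < C) :
    P.real {ω | firstIndex (fun m => c + 1 ≤ nodesLost t Δ n m ω) <
        min (firstIndex fun m => C ≤ nodesLost t Δ n m ω)
          (firstIndex fun m => V < weightLost t Δ n w m ω)} =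
      regGammaP c (xi * V) - rFun lam mu a xi V c (C - 2) 1 0 0 / dFun lam mu a 0 ^ c
        - dFun lam mu a 0 ^ (C - (c + 1)) * regGammaP ((C - 1 : ℕ) : ℝ) (xi * V) := by
  have hxV : 0 ≤ xi * V := by positivity
  obtain ⟨k, rfl⟩ : ∃ k, C = c + 1 + k := ⟨C - (c + 1), by omega⟩
  rw [h.measureReal_firstIndex_lt_min hlam hmu ha ha1 hxi hV (Nat.le_add_left 1 c),
    sum_geometric_mul_erlangCDF (dFun_zero_pos hlam hmu ha1).ne', regGammaP_natCast _ hxV,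
    regGammaP_natCast _ hxV]
  have h1 : c + 1 + k - 1 = c + k := by omega
  have h2 : c + 1 + k - (c + 1) = k := by omega
  have h3 : Finset.Icc c (c + 1 + k - 2) = Finset.Ico c (c + k) := by
    ext i
    simp only [Finset.mem_Icc, Finset.mem_Ico]
    omega
  have h4 : xi * dFun lam mu a 0 * 1 * V = dFun lam mu a 0 * (xi * V) := by ring
  rw [h1, h2, rFun, h3, h4, zero_add, neg_mul]

end IsModel

end

end NetworkAttack

theorem corollary5p2 {Ω : Type*} [MeasurableSpace Ω] (P : Measure Ω) [IsProbabilityMeasure P]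
    (t Δ : ℕ → Ω → ℝ) (n : ℕ → Ω → ℕ) (w : ℕ → ℕ → Ω → ℝ)
    (lam mu a xi V : ℝ) (hlam : 0 < lam) (hmu : 0 < mu) (ha : 0 < a) (ha1 : a ≤ 1)
    (hxi : 0 < xi) (hV : 0 < V)
    (hmodel : NetworkAttack.IsModel P t Δ n w lam mu a xi)
    (M₁ M : ℕ) (hM₁ : 1 ≤ M₁) (hM : M₁ + 1 < M) :
    -- levels `M₁`, `M` crossed when reached (`N_m ≥ M₁`, `N_m ≥ M`)
    P.real {ω |
        NetworkAttack.firstIndex (fun m => M₁ ≤ NetworkAttack.nodesLost t Δ n m ω) <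
          min (NetworkAttack.firstIndex (fun m => M ≤ NetworkAttack.nodesLost t Δ n m ω))
            (NetworkAttack.firstIndex (fun m => V < NetworkAttack.weightLost t Δ n w m ω))} =
      NetworkAttack.regGammaP ((M₁ : ℝ) - 1) (xi * V)
        - NetworkAttack.rFun lam mu a xi V (M₁ - 1) (M - 2) 1 0 0
            / NetworkAttack.dFun lam mu a 0 ^ (M₁ - 1)
        - NetworkAttack.dFun lam mu a 0 ^ (M - M₁)
            * NetworkAttack.regGammaP ((M : ℝ) - 1) (xi * V) ∧
    -- levels `M₁`, `M` crossed when exceeded (`N_m > M₁`, `N_m > M`)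
    P.real {ω |
        NetworkAttack.firstIndex (fun m => M₁ < NetworkAttack.nodesLost t Δ n m ω) <
          min (NetworkAttack.firstIndex (fun m => M < NetworkAttack.nodesLost t Δ n m ω))
            (NetworkAttack.firstIndex (fun m => V < NetworkAttack.weightLost t Δ n w m ω))} =
      NetworkAttack.regGammaP (M₁ : ℝ) (xi * V)
        - NetworkAttack.rFun lam mu a xi V M₁ (M - 1) 1 0 0
            / NetworkAttack.dFun lam mu a 0 ^ M₁
        - NetworkAttack.dFun lam mu a 0 ^ (M - M₁)
            * NetworkAttack.regGammaP (M : ℝ) (xi * V) := by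
  constructor
  · have h := hmodel.measureReal_firstIndex_lt_min_eq hlam hmu ha ha1 hxi hV.le
      (c := M₁ - 1) (C := M) (by omega)
    rw [Nat.sub_add_cancel hM₁] at h
    rw [h, Nat.cast_sub hM₁, Nat.cast_sub (by omega : 1 ≤ M), Nat.cast_one]
  · have h := hmodel.measureReal_firstIndex_lt_min_eq hlam hmu ha ha1 hxi hV.le
      (c := M₁) (C := M + 1) (by omega)
    have h1 : M + 1 - 2 = M - 1 := by omega
    have h2 : M + 1 - (M₁ + 1) = M - M₁ := by omega
    rw [h1, h2, Nat.add_sub_cancel] at h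
    exact h
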